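/- **Theorem (power balance of Maxwell's equations / Poynting's theorem).** Let $\Omega\subset\mathbb R^3$ be an open set with locally Lipschitz boundary (not necessarily bounded), with outer unit normal $\boldsymbol n$ and surface measure $\mathrm ds$ on $\partial\Omega$; let $\varepsilon_0>0$, $\mu_0>0$, and let $I\subset\mathbb R$ be a set of times (for instance an interval). Let $\boldsymbol D,\boldsymbol B,\boldsymbol E,\boldsymbol H,\boldsymbol J$ be functions of time with values in $L^2(\Omega;\mathbb R^3)$ such that for all $t\in I$ $$\boldsymbol E=\tfrac1{\varepsilon_0}\boldsymbol D,\qquad \boldsymbol H=\tfrac1{\mu_0}\boldsymbol B,\qquad \partial_t\boldsymbol D=\mathbf{curl}\,\boldsymbol H-\boldsymbol J,\qquad \partial_t\boldsymbol B=-\mathbf{curl}\,\boldsymbol E ,$$ where $\boldsymbol E(t),\boldsymbol H(t)\in H^{\mathbf{curl}}(\Omega)=\{u\in L^2(\Omega;\mathbb R^3):\mathbf{curl}\,u\in L^2(\Omega;\mathbb R^3)\}$, $\mathbf{curl}$ is taken in the sense of distributions, and the time derivatives are derivatives relative to $I$ in $L^2(\Omega;\mathbb R^3)$. Let $$H_{EM}=\frac12\int_\Omega\frac1{\varepsilon_0}|\boldsymbol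 D|^2+\frac1{\mu_0}|\boldsymbol B|^2\,\mathrm dx .$$ Then, at every $t\in I$, $H_{EM}$ is differentiable (relative to $I$) and $$\frac{\mathrm d}{\mathrm dt}H_{EM}=\int_{\partial\Omega}(\boldsymbol H\times\boldsymbol E)\cdot\boldsymbol n\,\mathrm ds-\int_\Omega\boldsymbol J\cdot\boldsymbol E\,\mathrm dx .$$ Here the boundary term for fields $u,v\in H^{\mathbf{curl}}(\Omega)$ is the extension by continuity of the surface integral: $u$ and $v$ are limits in $H^{\mathbf{curl}}(\Omega)$ of restrictions to $\Omega$ of compactly supported $C^1$ fields on $\mathbb R^3$, and for all such approximations $u_k\to u$, $v_k\to v$ the surface integrals $\int_{\partial\Omega}(u_k\times v_k)\cdot\boldsymbol n\,\mathrm ds$ converge to one and the same number, denoted $\int_{\partial\Omega}(u\times v)\cdot\boldsymbol n\,\mathrm ds$ (that this is so for $\boldsymbol H(t),\boldsymbol E(t)$ is part of the claim). If $\boldsymbol H(t)$ and $\boldsymbol E(t)$ coincide a.e. on $\Omega$ with compactly supported $C^1$ fields on $\mathbb R^3$, the integrand $(\boldsymbol H\times\boldsymbol E)\cdot\boldsymbol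 n$ of these $C^1$ fields is integrable on $\partial\Omega$ and the boundary term is its surface integral in the ordinary sense. -/

import Mathlib

open MeasureTheory Set Filter Topology
open scoped ContDiff NNReal ENNReal Matrix

namespace Maxwell

/-- Physical space `ℝ³` with its Euclidean norm. -/
abbrev E3 : Type := EuclideanSpace ℝ (Fin 3)

/-! ### The domain, its surface measure and its outer unit normal -/

/-- `Ω` is an open set with (locally) Lipschitz boundary: near each boundary point, in suitable
orthonormal coordinates, `Ω` is the set of points lying below the graph of a Lipschitz function.
Neither boundedness nor connectedness is required. -/
structure IsLipschitzDomain (Ω : Set E3) : Prop where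
  isOpen : IsOpen Ω
  locally_below_graph : ∀ x ∈ frontier Ω, ∃ r > 0, ∃ e : E3 ≃ₗᵢ[ℝ] E3,
    ∃ (K : ℝ≥0) (g : EuclideanSpace ℝ (Fin 2) → ℝ), LipschitzWith K g ∧
      ∀ y ∈ Metric.ball x r, (y ∈ Ω ↔ e y 2 < g !₂[e y 0, e y 1])

/-- The unit vector `n` is the outer unit normal of `Ω` at `x`: for every `ε > 0`, near `x` the open
cone `⟪n, y - x⟫ < -ε ‖y - x‖` lies inside `Ω` and the open cone `⟪n, y - x⟫ > ε ‖y - x‖` lies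
outside `Ω`. There is at most one such `n`. -/
def IsOuterNormal (Ω : Set E3) (x n : E3) : Prop :=
  ‖n‖ = 1 ∧ ∀ ε > 0, ∀ᶠ y in 𝓝 x,
    (inner ℝ n (y - x) < -ε * ‖y - x‖ → y ∈ Ω) ∧
    (ε * ‖y - x‖ < inner ℝ n (y - x) → y ∉ Ω)

open Classical in
/-- The outer unit normal field; it is set to `0` at the points without an outer unit normal (for a
Lipschitz boundary these form a set of zero surface area). -/
noncomputable def outerNormal (Ω : Set E3) (x : E3) : E3 :=
  if h : ∃ n, IsOuterNormal Ω x n then h.choose else 0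

/-- The cross product on `ℝ³`. -/
noncomputable def cross (a b : E3) : E3 := WithLp.toLp 2 (a.ofLp ⨯₃ b.ofLp)

/-- The integrand `(h × e) · n` on the boundary. -/
noncomputable def fluxDensity (Ω : Set E3) (h e : E3 → E3) (x : E3) : ℝ :=
  inner ℝ (cross (h x) (e x)) (outerNormal Ω x)

/-- The surface integral `∫_{∂Ω} (h × e) · n ds`; `ds` is the area measure, i.e. the two-dimensional
Hausdorff measure normalized to agree with Lebesgue measure on planes. -/
noncomputable def surfaceFlux (Ω : Set E3) (h e : E3 → E3) : ℝ :=
  ∫ x in frontier Ω, fluxDensity Ω h e x ∂μHE[2]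

/-! ### The operator curl -/

/-- The partial derivative `∂ᵢ uⱼ (x)`. -/
noncomputable def partialD (u : E3 → E3) (i j : Fin 3) (x : E3) : ℝ :=
  fderiv ℝ u x (EuclideanSpace.single i 1) j

/-- The classical curl of a differentiable vector field. -/
noncomputable def curl (u : E3 → E3) (x : E3) : E3 :=
  !₂[partialD u 1 2 x - partialD u 2 1 x,
     partialD u 2 0 x - partialD u 0 2 x,
     partialD u 0 1 x - partialD u 1 0 x]

/-- The space `L²(Ω; ℝ³)`. -/
abbrev L2Field (Ω : Set E3) : Type := Lp E3 2 ((volume : Measure E3).restrict Ω)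

/-- `w = curl u` in the sense of distributions on `Ω`. Thus `u ∈ H^curl(Ω)` iff
`HasWeakCurl Ω u w` for some `w`. -/
def HasWeakCurl (Ω : Set E3) (u w : L2Field Ω) : Prop :=
  ∀ φ : E3 → E3, ContDiff ℝ ∞ φ → HasCompactSupport φ → tsupport φ ⊆ Ω →
    ∫ x in Ω, inner ℝ (u x) (curl φ x) = ∫ x in Ω, inner ℝ (w x) (φ x)

/-! ### The boundary term for fields in `H^curl(Ω)` -/

/-- Vector fields of class `C¹` with compact support in `ℝ³`; their restrictions to `Ω` are fields
that are `C¹` up to the boundary. -/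
def IsC1Field (f : E3 → E3) : Prop := ContDiff ℝ 1 f ∧ HasCompactSupport f

/-- `u` belongs to `H^curl(Ω)` and the fields `f k`, of class `C¹` up to the boundary, converge to
`u` in `H^curl(Ω)`. -/
def ApproximatesInHCurl (Ω : Set E3) (f : ℕ → E3 → E3) (u : L2Field Ω) : Prop :=
  (∀ k, IsC1Field (f k)) ∧ ∃ w : L2Field Ω, HasWeakCurl Ω u w ∧
    Tendsto (fun k => eLpNorm (fun x => f k x - u x) 2 (volume.restrict Ω)) atTop (𝓝 0) ∧
    Tendsto (fun k => eLpNorm (fun x => curl (f k) x - w x) 2 (volume.restrict Ω)) atTop (𝓝 0)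

/-- `P` is the value of `∫_{∂Ω} (u × v) · n ds` for `u, v ∈ H^curl(Ω)`, the integral being extended
by continuity from fields that are `C¹` up to the boundary: such fields approximate `u` and `v`, and
along every approximation the surface integrals converge to `P`. -/
def HasBoundaryFlux (Ω : Set E3) (u v : L2Field Ω) (P : ℝ) : Prop :=
  (∃ f, ApproximatesInHCurl Ω f u) ∧ (∃ g, ApproximatesInHCurl Ω g v) ∧
    ∀ f g, ApproximatesInHCurl Ω f u → ApproximatesInHCurl Ω g v →
      Tendsto (fun k => surfaceFlux Ω (f k) (g k)) atTop (𝓝 P)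

/-! ### Maxwell's equations -/

/-- The electromagnetic energy `½ ∫_Ω |D|²/ε₀ + |B|²/μ₀ dx`. -/
noncomputable def hamiltonian (Ω : Set E3) (ε₀ μ₀ : ℝ) (D B : L2Field Ω) : ℝ :=
  (1 / 2) * ∫ x in Ω, ((1 / ε₀) * ‖D x‖ ^ 2 + (1 / μ₀) * ‖B x‖ ^ 2)

/-- `D`, `B` solve Maxwell's equations `∂ₜ D = curl H - J`, `∂ₜ B = -curl E` on `Ω` for times in
`I`, with `E = D / ε₀` and `H = B / μ₀`. At each time `E` and `H` belong to `H^curl(Ω)` and the time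
derivatives (one-sided at end points of `I` that belong to `I`) are taken in `L²(Ω; ℝ³)`. -/
structure IsSolution (Ω : Set E3) (ε₀ μ₀ : ℝ) (I : Set ℝ) (D B E H J : ℝ → L2Field Ω) : Prop where
  electric_law : ∀ t ∈ I, E t = (1 / ε₀) • D t
  magnetic_law : ∀ t ∈ I, H t = (1 / μ₀) • B t
  ampere : ∀ t ∈ I, ∃ curlH : L2Field Ω, HasWeakCurl Ω (H t) curlH ∧
    HasDerivWithinAt D (curlH - J t) I t
  faraday : ∀ t ∈ I, ∃ curlE : L2Field Ω, HasWeakCurl Ω (E t) curlE ∧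
    HasDerivWithinAt B (-curlE) I t

end Maxwell

namespace Maxwell

/-! ### The area formula for Lipschitz graphs -/

/-! Differentiating the squared `L²` norms and inserting Maxwell's equations gives the rate of
change `⟪E, curl H⟫ - ⟪H, curl E⟫ - ⟪J, E⟫`. The substance of the theorem is that the first two
terms form the boundary flux of `H` and `E`.

For compactly supported `C¹` fields this is Green's formula (`IsLipschitzDomain.surfaceFlux_eq`):
the divergence theorem applied to `h × e`, whose divergence is `e · curl h - h · curl e`. Its volume
side is continuous for `H^curl` convergence, so along all approximations the surface integrals have
the same limit. Constant sequences then identify this limit with the ordinary surface integral when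
the fields are `C¹`.

Two analytic facts carry the argument. The first is the divergence theorem with Hausdorff surface
measure. Rademacher's theorem and a partition into nearly linear pieces give the area formula for
Lipschitz graphs (`IsGraphMap.measure_image`). A shear reduces the integral over a subgraph to
one-dimensional calculus (`setIntegral_subgraph_divergence`), and a partition of unity globalizes
the result.

The second is density of `C¹` fields in `H^curl(Ω)`, proved by duality. If `(a, b)` is orthogonal to
all `(φ, curl φ)`, then the extension of `b` by zero has distributional curl minus the extension of
`a` on all of `ℝ³`. Such a field is localized and mollified with kernels that shift its support into
`Ω`, which produces admissible test fields; removing the shift by continuity of translations in `L²`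
shows that `(a, b)` is orthogonal to every `(u, curl u)`. -/

theorem euclideanHausdorffMeasure_image_le {X Y : Type*} [MetricSpace X] [MetricSpace Y]
    [MeasurableSpace X] [BorelSpace X] [MeasurableSpace Y] [BorelSpace Y] {K : ℝ≥0} {f : X → Y}
    {s : Set X} (h : LipschitzOnWith K f s) (d : ℕ) :
    μHE[d] (f '' s) ≤ (K : ℝ≥0∞) ^ d * μHE[d] s := by
  have := h.hausdorffMeasure_image_le (d := d) (by positivity)
  simp only [Measure.euclideanHausdorffMeasure_def, Measure.smul_apply]
  rw [ENNReal.rpow_natCast] at this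
  calc _ ≤ _ • ((K : ℝ≥0∞) ^ d * μH[d] s) := by gcongr
    _ = _ := by rw [mul_smul_comm]

section Graph

variable {d : ℕ} {X : Type*} [MetricSpace X]

local notation "V" => EuclideanSpace ℝ (Fin d)

/-- The area element of a graph with slope `a`. -/
noncomputable def areaFactor (a : V) : ℝ := √(1 + ‖a‖ ^ 2)

theorem one_le_areaFactor (a : V) : 1 ≤ areaFactor a :=
  Real.one_le_sqrt.2 (by nlinarith [sq_nonneg ‖a‖])

theorem areaFactor_sq (a : V) : areaFactor a ^ 2 = 1 + ‖a‖ ^ 2 :=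
  Real.sq_sqrt (by positivity)

theorem continuous_areaFactor : Continuous (areaFactor : V → ℝ) := by
  unfold areaFactor; fun_prop

/-- Since area factors are at least `1`, this additive bound also controls the relative error when a
gradient is replaced by a nearby constant slope. -/
theorem areaFactor_le_add (a b : V) : areaFactor a ≤ areaFactor b + ‖a - b‖ := by
  have hb := one_le_areaFactor b
  apply Real.sqrt_le_iff.2 ⟨by positivity, ?_⟩
  have h1 : ‖a‖ ≤ ‖b‖ + ‖a - b‖ := norm_le_norm_add_norm_sub' a b
  have h2 : ‖b‖ ≤ areaFactor b := Real.le_sqrt_of_sq_le (by linarith)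
  nlinarith [areaFactor_sq b, norm_nonneg a, norm_nonneg b, norm_nonneg (a - b)]

/-- The symmetric stretching `x ↦ x + c ⟪a, x⟫ a` that maps a hyperplane of slope `a`, projected to
`V`, isometrically onto `V`. -/
noncomputable def graphStretch (a : V) : V →ₗ[ℝ] V :=
  LinearMap.transvection (innerₛₗ ℝ a) ((1 + areaFactor a)⁻¹ • a)

theorem graphStretch_apply (a x : V) :
    graphStretch a x = x + inner ℝ a x • ((1 + areaFactor a)⁻¹ • a) := rfl

/-- With `J = areaFactor a`, `c = (1 + J)⁻¹` and `‖a‖² = J² - 1`, the coefficient of `⟪a, x⟫²` is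
`2c + c²‖a‖² = 1`. The right side is the squared length of `x` lifted to the hyperplane of slope
`a`. -/
theorem norm_graphStretch_sq (a x : V) :
    ‖graphStretch a x‖ ^ 2 = ‖x‖ ^ 2 + inner ℝ a x ^ 2 := by
  have hJ := one_le_areaFactor a
  have hJ2 := areaFactor_sq a
  rw [graphStretch_apply, norm_add_sq_real, norm_smul, norm_smul, inner_smul_right,
    inner_smul_right, real_inner_comm x a, mul_pow, mul_pow, Real.norm_eq_abs, Real.norm_eq_abs,
    sq_abs, sq_abs]
  have : ‖a‖ ^ 2 = areaFactor a ^ 2 - 1 := by linarith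
  rw [this]
  field_simp
  ring

theorem det_graphStretch (a : V) : LinearMap.det (graphStretch a) = areaFactor a := by
  have hJ := one_le_areaFactor a
  have hJ2 := areaFactor_sq a
  rw [graphStretch, LinearMap.transvection.det, innerₛₗ_apply_apply, inner_smul_right,
    real_inner_self_eq_norm_sq]
  have : ‖a‖ ^ 2 = areaFactor a ^ 2 - 1 := by linarith
  rw [this]
  field_simp
  ring

/-- `Ψ` parametrizes the graph of `g` (up to an isometry). -/
def IsGraphMap (g : V → ℝ) (Ψ : V → X) : Prop :=
  ∀ x y, dist (Ψ x) (Ψ y) ^ 2 = ‖x - y‖ ^ 2 + (g x - g y) ^ 2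

/-- For the two lengths `p`, `q` and height differences `s`, `r` one has `p² - q² = s² - r²`, `|s| ≤
p` and `|r| ≤ q`. Dividing by `p + q` gives `|p - q| ≤ |s - r|`, and the stretching does not shrink
`x - y`. -/
theorem IsGraphMap.abs_dist_sub_le {g : V → ℝ} {Ψ : V → X} (hΨ : IsGraphMap g Ψ) {a x y : V}
    {δ : ℝ} (h : |g x - g y - inner ℝ a (x - y)| ≤ δ * ‖x - y‖) :
    |dist (Ψ x) (Ψ y) - ‖graphStretch a (x - y)‖| ≤ δ * ‖graphStretch a (x - y)‖ := by
  set p := dist (Ψ x) (Ψ y)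
  set q := ‖graphStretch a (x - y)‖
  have hp : p ^ 2 = ‖x - y‖ ^ 2 + (g x - g y) ^ 2 := hΨ x y
  have hq : q ^ 2 = ‖x - y‖ ^ 2 + inner ℝ a (x - y) ^ 2 := norm_graphStretch_sq a _
  have hp0 : 0 ≤ p := dist_nonneg
  have hq0 : 0 ≤ q := norm_nonneg _
  set s := g x - g y
  set r := inner ℝ a (x - y)
  set m := ‖x - y‖
  have hm : 0 ≤ m := norm_nonneg _
  have hmq : m ≤ q := by apply le_of_sq_le_sq _ hq0; nlinarith [sq_nonneg r]
  have hpq : |p - q| ≤ |s - r| := by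
    by_cases h0 : p + q = 0
    · have : p = 0 := by linarith
      have : q = 0 := by linarith
      simp [*]
    have h1 : |p - q| * (p + q) = |s - r| * |s + r| := by
      have h2 : (p - q) * (p + q) = (s - r) * (s + r) := by linarith
      rw [← abs_mul, ← h2, abs_mul, abs_of_nonneg (add_nonneg hp0 hq0)]
    have hs : |s| ≤ p := abs_le_of_sq_le_sq (by nlinarith [sq_nonneg m]) hp0
    have hr : |r| ≤ q := abs_le_of_sq_le_sq (by nlinarith [sq_nonneg m]) hq0
    have h2 : |s + r| ≤ p + q := (abs_add_le s r).trans (add_le_add hs hr)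
    have h3 : 0 < p + q := lt_of_le_of_ne (by positivity) (Ne.symm h0)
    refine le_of_mul_le_mul_right ?_ h3
    rw [h1]
    gcongr
  -- The sign of `δ` is not assumed; the hypothesis forces `δ ≥ 0` only when `x ≠ y`.
  by_cases hm0 : m = 0
  · rw [hm0, mul_zero] at h
    have h' : |s - r| = 0 := le_antisymm h (abs_nonneg _)
    have hxy : x - y = 0 := norm_eq_zero.1 hm0
    have hq' : q = 0 := by simp [q, hxy]
    exact (hpq.trans h'.le).trans (by rw [hq', mul_zero])
  · have hδ : 0 ≤ δ := by
      have : 0 < m := lt_of_le_of_ne hm (Ne.symm hm0)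
      exact nonneg_of_mul_nonneg_left ((abs_nonneg _).trans h) this
    exact hpq.trans (h.trans (by gcongr))

theorem IsGraphMap.injective {g : V → ℝ} {Ψ : V → X} (hΨ : IsGraphMap g Ψ) :
    Function.Injective Ψ := by
  intro x y hxy
  have := hΨ x y
  rw [hxy, dist_self] at this
  have h : ‖x - y‖ ^ 2 = 0 := by nlinarith [sq_nonneg (g x - g y), sq_nonneg ‖x - y‖]
  exact sub_eq_zero.1 (norm_eq_zero.1 (pow_eq_zero_iff two_ne_zero |>.1 h))

theorem IsGraphMap.lipschitzWith {g : V → ℝ} {Ψ : V → X} (hΨ : IsGraphMap g Ψ) {K : ℝ≥0}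
    (hg : LipschitzWith K g) : LipschitzWith (1 + K) Ψ := by
  apply LipschitzWith.of_dist_le_mul
  intro x y
  have h1 := hg.dist_le_mul x y
  rw [Real.dist_eq] at h1
  apply le_of_sq_le_sq _ (by positivity)
  rw [hΨ x y, dist_eq_norm]
  rw [dist_eq_norm] at h1
  push_cast
  nlinarith [sq_abs (g x - g y), abs_nonneg (g x - g y), norm_nonneg (x - y), K.coe_nonneg,
    mul_nonneg K.coe_nonneg (norm_nonneg (x - y))]

theorem IsGraphMap.antilipschitzWith {g : V → ℝ} {Ψ : V → X} (hΨ : IsGraphMap g Ψ) :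
    AntilipschitzWith 1 Ψ := by
  apply AntilipschitzWith.of_le_mul_dist
  intro x y
  rw [NNReal.coe_one, one_mul, dist_eq_norm]
  apply le_of_sq_le_sq _ dist_nonneg
  rw [hΨ x y]
  nlinarith [sq_nonneg (g x - g y)]

theorem IsGraphMap.isClosedEmbedding {g : V → ℝ} {Ψ : V → X} (hΨ : IsGraphMap g Ψ) {K : ℝ≥0}
    (hg : LipschitzWith K g) : IsClosedEmbedding Ψ :=
  hΨ.antilipschitzWith.isClosedEmbedding (hΨ.lipschitzWith hg).uniformContinuous

variable [MeasurableSpace X] [BorelSpace X]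

/-- Two-sided comparison on a set where `g` is close to a linear function. -/
theorem IsGraphMap.measure_image_bounds {g : V → ℝ} {Ψ : V → X} (hΨ : IsGraphMap g Ψ) {a : V}
    {κ : ℝ≥0} (hκ : 1 < κ) {s : Set V}
    (h : ∀ x ∈ s, ∀ y ∈ s, |g x - g y - inner ℝ a (x - y)| ≤ (1 - (κ : ℝ)⁻¹) * ‖x - y‖) :
    μHE[d] (Ψ '' s) ≤ (κ : ℝ≥0∞) ^ d * (ENNReal.ofReal (areaFactor a) * volume s) ∧
    ENNReal.ofReal (areaFactor a) * volume s ≤ (κ : ℝ≥0∞) ^ d * μHE[d] (Ψ '' s) := by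
  have hκ' : (1 : ℝ) < κ := hκ
  have hκ0 : (0 : ℝ) < κ := by linarith
  have hinj : Function.Injective (graphStretch a) := by
    intro x y hxy
    have h0 := norm_graphStretch_sq a (x - y)
    rw [map_sub, hxy, sub_self, norm_zero] at h0
    have h1 : ‖x - y‖ ^ 2 = 0 := by
      nlinarith [sq_nonneg (inner ℝ a (x - y)), sq_nonneg ‖x - y‖]
    exact sub_eq_zero.1 (norm_eq_zero.1 (pow_eq_zero_iff two_ne_zero |>.1 h1))
  have hvol : μHE[d] (graphStretch a '' s) = ENNReal.ofReal (areaFactor a) * volume s := by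
    rw [EuclideanSpace.euclideanHausdorffMeasure_eq_volume, Measure.addHaar_image_linearMap,
      det_graphStretch, abs_of_nonneg (zero_le_one.trans (one_le_areaFactor a))]
  have key : ∀ x ∈ s, ∀ y ∈ s, |dist (Ψ x) (Ψ y) - dist (graphStretch a x) (graphStretch a y)| ≤
      (1 - (κ : ℝ)⁻¹) * dist (graphStretch a x) (graphStretch a y) := by
    intro x hx y hy
    rw [dist_eq_norm (graphStretch a x), ← map_sub]
    exact hΨ.abs_dist_sub_le (h x hx y hy)
  have hid : (κ : ℝ) * (κ : ℝ)⁻¹ = 1 := mul_inv_cancel₀ hκ0.ne'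
  have hi0 : 0 < (κ : ℝ)⁻¹ := by positivity
  constructor
  -- With `δ = 1 - κ⁻¹`, graph distances and stretched distances have ratio between `1 - δ = κ⁻¹`
  -- and `1 + δ ≤ κ`, so the transition maps in both directions are `κ`-Lipschitz.
  · have hL : LipschitzOnWith κ (Ψ ∘ Function.invFun (graphStretch a)) (graphStretch a '' s) := by
      apply LipschitzOnWith.of_dist_le_mul
      rintro _ ⟨x, hx, rfl⟩ _ ⟨y, hy, rfl⟩
      simp only [Function.comp_apply, Function.leftInverse_invFun hinj _]
      have := (abs_le.1 (key x hx y hy)).2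
      have h2 : 2 - (κ : ℝ)⁻¹ ≤ κ := by nlinarith [mul_nonneg (sq_nonneg ((κ : ℝ) - 1)) hi0.le]
      nlinarith [dist_nonneg (x := graphStretch a x) (y := graphStretch a y)]
    have := euclideanHausdorffMeasure_image_le hL d
    rwa [hvol, image_image, image_congr (g := Ψ)] at this
    intro x _
    simp only [Function.comp_apply, Function.leftInverse_invFun hinj _]
  · have hL : LipschitzOnWith κ (graphStretch a ∘ Function.invFun Ψ) (Ψ '' s) := by
      apply LipschitzOnWith.of_dist_le_mul
      rintro _ ⟨x, hx, rfl⟩ _ ⟨y, hy, rfl⟩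
      simp only [Function.comp_apply, Function.leftInverse_invFun hΨ.injective _]
      have := (abs_le.1 (key x hx y hy)).1
      have h2 : (κ : ℝ)⁻¹ * dist (graphStretch a x) (graphStretch a y) ≤ dist (Ψ x) (Ψ y) := by
        linarith
      calc _ = κ * ((κ : ℝ)⁻¹ * dist (graphStretch a x) (graphStretch a y)) := by
            rw [← mul_assoc, hid, one_mul]
        _ ≤ _ := by gcongr
    have := euclideanHausdorffMeasure_image_le hL d
    rwa [image_image, image_congr (g := graphStretch a), hvol] at this
    intro x _
    simp only [Function.comp_apply, Function.leftInverse_invFun hΨ.injective _]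

/-- Multiplying `f` by a fixed unit vector gives a map from `E` to itself with unchanged norms, to
which `ApproximatesLinearOn.norm_fderiv_sub_le` applies. -/
theorem ae_norm_fderiv_sub_le_of_approximatesLinearOn {E : Type*} [NormedAddCommGroup E]
    [NormedSpace ℝ E] [FiniteDimensional ℝ E] [MeasurableSpace E] [BorelSpace E] (μ : Measure E)
    [μ.IsAddHaarMeasure] {f : E → ℝ} {A : E →L[ℝ] ℝ} {s : Set E} {δ : ℝ≥0}
    (hf : ApproximatesLinearOn f A s δ) (hs : MeasurableSet s) (f' : E → E →L[ℝ] ℝ)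
    (hf' : ∀ x ∈ s, HasFDerivWithinAt f (f' x) s x) : ∀ᵐ x ∂μ.restrict s, ‖f' x - A‖ ≤ δ := by
  rcases subsingleton_or_nontrivial E with hE | hE
  · refine Eventually.of_forall fun x => ?_
    have : f' x - A = 0 := by ext v; simp [Subsingleton.elim v 0]
    simp [this]
  obtain ⟨v, hv⟩ := exists_norm_eq E zero_le_one
  have h1 : ApproximatesLinearOn (fun x => f x • v) (A.smulRight v) s δ := by
    intro x hx y hy
    have := hf x hx y hy
    simp only [ContinuousLinearMap.smulRight_apply, ← sub_smul, norm_smul, hv, mul_one]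
    exact this
  have h2 : ∀ x ∈ s, HasFDerivWithinAt (fun x => f x • v) ((f' x).smulRight v) s x := fun x hx =>
    (hf' x hx).smul_const v
  filter_upwards [h1.norm_fderiv_sub_le μ hs _ h2] with x hx
  have h3 : (f' x).smulRight v - A.smulRight v = (f' x - A).smulRight v := by
    ext w; simp [sub_smul]
  rw [h3] at hx
  have : ‖(f' x - A).smulRight v‖ = ‖f' x - A‖ := by
    rw [ContinuousLinearMap.norm_smulRight_apply, hv, mul_one]
  rw [← this]
  exact hx

theorem measurable_gradient_real (g : V → ℝ) : Measurable (gradient g) :=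
  (InnerProductSpace.toDual ℝ V).symm.continuous.measurable.comp (measurable_fderiv ℝ g)

/-- The differentiability set of `g` splits into countably many measurable pieces on which `g` is
nearly linear; its complement is null for both measures by Rademacher and the Lipschitz bound on
`Ψ`. In `κ ^ (d + 1)`, `d` factors come from comparing the graph with a plane and one from the
oscillation of the area factor. -/
theorem IsGraphMap.measure_image_aux {g : V → ℝ} {Ψ : V → X} (hΨ : IsGraphMap g Ψ) {K : ℝ≥0}
    (hg : LipschitzWith K g) {κ : ℝ≥0} (hκ : 1 < κ) {s : Set V} (hs : MeasurableSet s) :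
    μHE[d] (Ψ '' s) ≤
      (κ : ℝ≥0∞) ^ (d + 1) * ∫⁻ x in s, ENNReal.ofReal (areaFactor (gradient g x)) ∧
    ∫⁻ x in s, ENNReal.ofReal (areaFactor (gradient g x)) ≤
      (κ : ℝ≥0∞) ^ (d + 1) * μHE[d] (Ψ '' s) := by
  have hemb := (hΨ.isClosedEmbedding hg).measurableEmbedding
  set ν : Measure V := (μHE[d] : Measure X).comap Ψ with hν
  have hν_apply : ∀ u, ν u = μHE[d] (Ψ '' u) := fun u => hemb.comap_apply _ u
  set lam : Measure V := volume.withDensity fun x => ENNReal.ofReal (areaFactor (gradient g x))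
  have hlam : ∀ u, MeasurableSet u →
      lam u = ∫⁻ x in u, ENNReal.ofReal (areaFactor (gradient g x)) :=
    fun u hu => withDensity_apply _ hu
  rw [← hν_apply, ← hlam s hs]
  have hκ' : (1 : ℝ) < κ := hκ
  have hκ0 : (0 : ℝ) < κ := by linarith
  have hid : (κ : ℝ) * (κ : ℝ)⁻¹ = 1 := mul_inv_cancel₀ hκ0.ne'
  have hδ : 0 < 1 - (κ : ℝ)⁻¹ := sub_pos.2 (inv_lt_one_of_one_lt₀ hκ')
  set δ : ℝ≥0 := ⟨1 - (κ : ℝ)⁻¹, hδ.le⟩ with hδdef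
  have hδκ : 1 + (δ : ℝ) ≤ κ := by
    change 1 + (1 - (κ : ℝ)⁻¹) ≤ κ
    nlinarith [mul_nonneg (sq_nonneg ((κ : ℝ) - 1)) (inv_pos.2 hκ0).le]
  set D : Set V := {x | DifferentiableAt ℝ g x}
  have hD : MeasurableSet D := measurableSet_of_differentiableAt ℝ g
  have hDae : volume Dᶜ = 0 := hg.ae_differentiableAt
  obtain ⟨t, A, ht_disj, ht_meas, ht_cover, ht_approx, -⟩ :=
    exists_partition_approximatesLinearOn_of_hasFDerivWithinAt g D (fderiv ℝ g)
      (fun x hx => (DifferentiableAt.hasFDerivAt hx).hasFDerivWithinAt) (fun _ => δ)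
      (fun _ => (show δ ≠ 0 from fun h => hδ.ne' (congrArg NNReal.toReal h)))
  have hnull : ν Dᶜ = 0 ∧ lam Dᶜ = 0 := by
    constructor
    · rw [hν_apply]
      have := euclideanHausdorffMeasure_image_le ((hΨ.lipschitzWith hg).lipschitzOnWith (s := Dᶜ)) d
      rw [EuclideanSpace.euclideanHausdorffMeasure_eq_volume, hDae, mul_zero] at this
      exact le_antisymm this zero_le
    · exact withDensity_absolutelyContinuous _ _ hDae
  have hsplit : ∀ m : Measure V, m Dᶜ = 0 → m s = ∑' n, m (s ∩ D ∩ t n) := by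
    intro m hm
    rw [← measure_iUnion (fun i j hij => (ht_disj hij).mono inter_subset_right inter_subset_right)
      (fun n => (hs.inter hD).inter (ht_meas n)), ← inter_iUnion,
      inter_eq_left.2 (inter_subset_right.trans ht_cover)]
    exact (measure_inter_conull hm).symm
  have hpiece : ∀ n, ν (s ∩ D ∩ t n) ≤ (κ : ℝ≥0∞) ^ (d + 1) * lam (s ∩ D ∩ t n) ∧
      lam (s ∩ D ∩ t n) ≤ (κ : ℝ≥0∞) ^ (d + 1) * ν (s ∩ D ∩ t n) := by
    intro n
    set u := s ∩ D ∩ t n with hu_def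
    have hu : MeasurableSet u := (hs.inter hD).inter (ht_meas n)
    have huD : u ⊆ D ∩ t n := fun x hx => ⟨hx.1.2, hx.2⟩
    have happ : ApproximatesLinearOn g (A n) u δ := (ht_approx n).mono_set huD
    set a : V := (InnerProductSpace.toDual ℝ V).symm (A n) with ha
    have haA : ∀ v, A n v = inner ℝ a v := fun v =>
      (InnerProductSpace.toDual_symm_apply (x := v) (y := A n)).symm
    have hb := hΨ.measure_image_bounds hκ (a := a) (s := u) (fun x hx y hy => by
      have := happ x hx y hy
      rw [haA] at this
      exact this)
    rw [← hν_apply] at hb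
    have hgrad : ∀ᵐ x ∂volume.restrict u, ‖gradient g x - a‖ ≤ δ := by
      filter_upwards [ae_norm_fderiv_sub_le_of_approximatesLinearOn volume happ hu (fderiv ℝ g)
        (fun x hx => (DifferentiableAt.hasFDerivAt (huD hx).1).hasFDerivWithinAt)] with x hx
      rwa [gradient, ha, ← map_sub, LinearIsometryEquiv.norm_map]
    have hJ : ∀ b c : V, ‖b - c‖ ≤ δ →
        ENNReal.ofReal (areaFactor b) ≤ κ * ENNReal.ofReal (areaFactor c) := by
      intro b c hbc
      rw [← ENNReal.ofReal_coe_nnreal, ← ENNReal.ofReal_mul hκ0.le]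
      apply ENNReal.ofReal_le_ofReal
      have h1 := areaFactor_le_add b c
      nlinarith [one_le_areaFactor c, δ.coe_nonneg]
    have hconst : ENNReal.ofReal (areaFactor a) * volume u =
        ∫⁻ _ in u, ENNReal.ofReal (areaFactor a) := (setLIntegral_const _ _).symm
    have h1 : ENNReal.ofReal (areaFactor a) * volume u ≤ κ * lam u := by
      rw [hconst, hlam u hu, ← lintegral_const_mul' _ _ ENNReal.coe_ne_top]
      apply lintegral_mono_ae
      filter_upwards [hgrad] with x hx
      exact hJ _ _ (by rwa [norm_sub_rev])
    have h2 : lam u ≤ κ * (ENNReal.ofReal (areaFactor a) * volume u) := by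
      rw [hconst, hlam u hu, ← lintegral_const_mul' _ _ ENNReal.coe_ne_top]
      apply lintegral_mono_ae
      filter_upwards [hgrad] with x hx
      exact hJ _ _ hx
    constructor
    · calc ν u ≤ _ := hb.1
        _ ≤ (κ : ℝ≥0∞) ^ d * (κ * lam u) := by gcongr
        _ = _ := by rw [pow_succ, mul_assoc]
    · calc lam u ≤ _ := h2
        _ ≤ κ * ((κ : ℝ≥0∞) ^ d * ν u) := mul_le_mul' le_rfl hb.2
        _ = _ := by rw [pow_succ', mul_assoc]
  rw [hsplit ν hnull.1, hsplit lam hnull.2, ← ENNReal.tsum_mul_left, ← ENNReal.tsum_mul_left]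
  exact ⟨ENNReal.tsum_le_tsum fun n => (hpiece n).1, ENNReal.tsum_le_tsum fun n => (hpiece n).2⟩

/-- The area formula for Lipschitz graphs. -/
theorem IsGraphMap.measure_image {g : V → ℝ} {Ψ : V → X} (hΨ : IsGraphMap g Ψ) {K : ℝ≥0}
    (hg : LipschitzWith K g) {s : Set V} (hs : MeasurableSet s) :
    μHE[d] (Ψ '' s) = ∫⁻ x in s, ENNReal.ofReal (areaFactor (gradient g x)) := by
  -- The estimates hold for every `κ > 1`; letting `κ` decrease to `1` removes the factor, also when
  -- the measure is infinite.
  have lim : ∀ A : ℝ≥0∞, Tendsto (fun κ : ℝ≥0 => (κ : ℝ≥0∞) ^ (d + 1) * A) (𝓝[>] 1) (𝓝 A) := by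
    intro A
    have h1 : Tendsto (fun κ : ℝ≥0 => (κ : ℝ≥0∞) ^ (d + 1)) (𝓝[>] 1) (𝓝 1) := by
      have : Tendsto (fun κ : ℝ≥0 => ((κ ^ (d + 1) : ℝ≥0) : ℝ≥0∞)) (𝓝 1)
          (𝓝 (((1 : ℝ≥0) ^ (d + 1) : ℝ≥0) : ℝ≥0∞)) :=
        ENNReal.tendsto_coe.2 ((continuous_pow _).tendsto _)
      simpa using this.mono_left nhdsWithin_le_nhds
    simpa using ENNReal.Tendsto.mul_const (b := A) h1 (Or.inl one_ne_zero)
  apply le_antisymm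
  · apply ge_of_tendsto (lim _)
    filter_upwards [self_mem_nhdsWithin] with κ hκ
    exact (hΨ.measure_image_aux hg hκ hs).1
  · apply ge_of_tendsto (lim _)
    filter_upwards [self_mem_nhdsWithin] with κ hκ
    exact (hΨ.measure_image_aux hg hκ hs).2

theorem IsGraphMap.comap_eq {g : V → ℝ} {Ψ : V → X} (hΨ : IsGraphMap g Ψ) {K : ℝ≥0}
    (hg : LipschitzWith K g) :
    (μHE[d] : Measure X).comap Ψ =
      volume.withDensity fun x => ENNReal.ofReal (areaFactor (gradient g x)) := by
  ext s hs
  rw [(hΨ.isClosedEmbedding hg).measurableEmbedding.comap_apply, withDensity_apply _ hs,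
    hΨ.measure_image hg hs]

theorem IsGraphMap.restrict_range_eq {g : V → ℝ} {Ψ : V → X} (hΨ : IsGraphMap g Ψ) {K : ℝ≥0}
    (hg : LipschitzWith K g) :
    (μHE[d] : Measure X).restrict (range Ψ) =
      (volume.withDensity fun x => ENNReal.ofReal (areaFactor (gradient g x))).map Ψ := by
  rw [← hΨ.comap_eq hg, (hΨ.isClosedEmbedding hg).measurableEmbedding.map_comap]

theorem measurable_areaFactor_gradient (g : V → ℝ) :
    Measurable fun x => areaFactor (gradient g x) :=
  continuous_areaFactor.measurable.comp (measurable_gradient_real g)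

theorem IsGraphMap.integrableOn_range_iff {g : V → ℝ} {Ψ : V → X} (hΨ : IsGraphMap g Ψ) {K : ℝ≥0}
    (hg : LipschitzWith K g) {f : X → ℝ} :
    IntegrableOn f (range Ψ) μHE[d] ↔
      Integrable fun x => areaFactor (gradient g x) * f (Ψ x) := by
  rw [IntegrableOn, hΨ.restrict_range_eq hg,
    (hΨ.isClosedEmbedding hg).measurableEmbedding.integrable_map_iff,
    integrable_withDensity_iff_integrable_smul' (measurable_areaFactor_gradient g).ennreal_ofReal
      (.of_forall fun _ => ENNReal.ofReal_lt_top)]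
  simp only [Function.comp_apply, smul_eq_mul,
    ENNReal.toReal_ofReal (zero_le_one.trans (one_le_areaFactor _))]

theorem IsGraphMap.setIntegral_range {g : V → ℝ} {Ψ : V → X} (hΨ : IsGraphMap g Ψ) {K : ℝ≥0}
    (hg : LipschitzWith K g) (f : X → ℝ) :
    ∫ x in range Ψ, f x ∂μHE[d] = ∫ x, areaFactor (gradient g x) * f (Ψ x) := by
  rw [hΨ.restrict_range_eq hg, (hΨ.isClosedEmbedding hg).measurableEmbedding.integral_map,
    integral_withDensity_eq_integral_toReal_smul
      (measurable_areaFactor_gradient g).ennreal_ofReal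
      (.of_forall fun _ => ENNReal.ofReal_lt_top)]
  simp only [smul_eq_mul, ENNReal.toReal_ofReal (zero_le_one.trans (one_le_areaFactor _))]

end Graph

/-! ### Integration of derivatives over subgraphs -/

section Subgraph

set_option linter.unusedSectionVars false

variable {E : Type*} [NormedAddCommGroup E] [NormedSpace ℝ E] [FiniteDimensional ℝ E]
  [MeasurableSpace E] [BorelSpace E] {μ : Measure E} [μ.IsAddHaarMeasure]

theorem integral_lineDeriv_eq_zero {φ : E → ℝ} {C : ℝ≥0} (hφ : LipschitzWith C φ)
    (hc : HasCompactSupport φ) (v : E) : ∫ y, lineDeriv ℝ φ y v ∂μ = 0 := by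
  have := LipschitzWith.integral_lineDeriv_mul_eq (μ := μ) (LipschitzWith.const (1 : ℝ)) hφ hc (-v)
  have h0 : ∀ x : E, lineDeriv ℝ (fun _ : E => (1 : ℝ)) x (-v) = 0 := fun x => by simp [lineDeriv]
  simpa [h0] using this.symm

theorem isClosedEmbedding_prodMk_left {X Y : Type*} [TopologicalSpace X] [TopologicalSpace Y]
    [T1Space Y] (y : Y) : IsClosedEmbedding (fun x : X => (x, y)) :=
  ⟨isEmbedding_prodMkLeft y, by
    have : range (fun x : X => (x, y)) = Prod.snd ⁻¹' {y} := by ext ⟨a, b⟩; simp [eq_comm]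
    rw [this]; exact isClosed_singleton.preimage continuous_snd⟩

theorem isClosedEmbedding_prodMk_right {X Y : Type*} [TopologicalSpace X] [TopologicalSpace Y]
    [T1Space X] (x : X) : IsClosedEmbedding (fun y : Y => (x, y)) :=
  ⟨isEmbedding_prodMkRight x, by
    have : range (fun y : Y => (x, y)) = Prod.fst ⁻¹' {x} := by ext ⟨a, b⟩; simp [eq_comm]
    rw [this]; exact isClosed_singleton.preimage continuous_fst⟩

/-- The shear `(y, τ) ↦ (y, g y + τ)`. -/
def shear (g : E → ℝ) (hg : Continuous g) : E × ℝ ≃ₜ E × ℝ where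
  toFun p := (p.1, g p.1 + p.2)
  invFun p := (p.1, -g p.1 + p.2)
  left_inv p := by simp
  right_inv p := by simp
  continuous_toFun := by fun_prop
  continuous_invFun := by fun_prop

theorem hasCompactSupport_comp_shear {F : E × ℝ → ℝ} (hF : HasCompactSupport F) {g : E → ℝ}
    (hg : Continuous g) : HasCompactSupport fun p : E × ℝ => F (p.1, g p.1 + p.2) :=
  HasCompactSupport.comp_homeomorph hF (shear g hg)

theorem hasCompactSupport_comp_graph {F : E × ℝ → ℝ} (hF : HasCompactSupport F) {g : E → ℝ}
    (hg : Continuous g) (τ : ℝ) : HasCompactSupport fun y : E => F (y, g y + τ) :=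
  HasCompactSupport.comp_isClosedEmbedding (hasCompactSupport_comp_shear hF hg)
    (isClosedEmbedding_prodMk_left τ)

theorem setIntegral_Iio_comp_add (a : ℝ) (h : ℝ → ℝ) :
    ∫ τ in Iio 0, h (a + τ) = ∫ τ in Iio a, h τ := by
  have := (measurePreserving_add_left volume a).setIntegral_preimage_emb
    (Homeomorph.addLeft a).measurableEmbedding h (Iio a)
  simpa using this

theorem setIntegral_Iio_fderiv_vertical {f : E × ℝ → ℝ} (hf : ContDiff ℝ 1 f)
    (hfc : HasCompactSupport f) (y : E) (a : ℝ) :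
    ∫ τ in Iio a, fderiv ℝ f (y, τ) (0, 1) = f (y, a) := by
  have hemb : IsClosedEmbedding (fun τ : ℝ => (y, τ)) := isClosedEmbedding_prodMk_right y
  have hd : ∀ τ, HasDerivAt (fun τ => f (y, τ)) (fderiv ℝ f (y, τ) (0, 1)) τ := fun τ =>
    ((hf.differentiable one_ne_zero _).hasFDerivAt.comp_hasDerivAt τ
      ((hasDerivAt_const τ y).prodMk (hasDerivAt_id τ)))
  have hc : HasCompactSupport (fun τ => f (y, τ)) := hfc.comp_isClosedEmbedding hemb
  have h1 : ContDiff ℝ 1 (fun τ => f (y, τ)) := hf.comp (by fun_prop)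
  rw [← integral_Iic_eq_integral_Iio, ← hc.integral_Iic_deriv_eq h1 a]
  exact integral_congr_ae (.of_forall fun τ => (hd τ).deriv.symm)

/-- The shear turns the subgraph into a half space. At fixed height `τ` over the graph, `y ↦ f (y, g
y + τ)` is Lipschitz with compact support, so its directional derivative integrates to zero; by the
chain rule `∂ᵥf` may be traded for `-∂ᵥg ∂_τ f`. Integrating over `τ < 0` leaves the value on the
graph. -/
theorem integral_subgraph_fderiv_horizontal {f : E × ℝ → ℝ} (hf : ContDiff ℝ 1 f)
    (hfc : HasCompactSupport f) {g : E → ℝ} {K : ℝ≥0} (hg : LipschitzWith K g)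
    (v : E) :
    ∫ y, (∫ τ in Iio (g y), fderiv ℝ f (y, τ) (v, 0)) ∂μ =
      - ∫ y, fderiv ℝ g y v * f (y, g y) ∂μ := by
  have hDc : ∀ w, Continuous fun p => fderiv ℝ f p w := fun w =>
    (hf.continuous_fderiv one_ne_zero).clm_apply continuous_const
  have hDs : ∀ w, HasCompactSupport fun p => fderiv ℝ f p w := fun w => hfc.fderiv_apply ℝ w
  have hint : ∀ w, Integrable (fun p : E × ℝ => fderiv ℝ f (p.1, g p.1 + p.2) w)
      (μ.prod (volume.restrict (Iio 0))) := by
    intro w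
    have h1 : Integrable (fun p : E × ℝ => fderiv ℝ f (p.1, g p.1 + p.2) w) (μ.prod volume) :=
      Continuous.integrable_of_hasCompactSupport
        ((hDc w).comp (shear g hg.continuous).continuous)
        (hasCompactSupport_comp_shear (hDs w) hg.continuous)
    have : μ.prod ((volume : Measure ℝ).restrict (Iio 0)) =
        (μ.prod volume).restrict (univ ×ˢ Iio 0) := by
      rw [← Measure.prod_restrict, Measure.restrict_univ]
    rw [this]
    exact h1.integrableOn
  have hint2 : Integrable (fun p : E × ℝ => fderiv ℝ g p.1 v *
      fderiv ℝ f (p.1, g p.1 + p.2) (0, 1)) (μ.prod (volume.restrict (Iio 0))) := by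
    refine (hint (0, 1)).bdd_mul (c := K * ‖v‖) ?_ (.of_forall fun p => ?_)
    · exact ((measurable_fderiv_apply_const ℝ g v).comp measurable_fst).aestronglyMeasurable
    · exact ((fderiv ℝ g p.1).le_opNorm v).trans
        (by gcongr; exact norm_fderiv_le_of_lipschitz ℝ hg)
  obtain ⟨C, hC⟩ := hf.lipschitzWith_of_hasCompactSupport hfc one_ne_zero
  have key : ∀ τ : ℝ, ∫ y, fderiv ℝ f (y, g y + τ) (v, 0) ∂μ =
      - ∫ y, fderiv ℝ g y v * fderiv ℝ f (y, g y + τ) (0, 1) ∂μ := by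
    intro τ
    have hcont : Continuous fun y => (y, g y + τ) := by
      have := hg.continuous
      fun_prop
    have hL : LipschitzWith (C * max 1 K) (fun y => f (y, g y + τ)) := by
      refine hC.comp ?_
      refine LipschitzWith.prodMk LipschitzWith.id ?_
      simpa using hg.add (LipschitzWith.const τ)
    have hS : HasCompactSupport (fun y => f (y, g y + τ)) :=
      hasCompactSupport_comp_graph hfc hg.continuous τ
    have hI : ∀ w, Integrable (fun y => fderiv ℝ f (y, g y + τ) w) μ := fun w =>
      Continuous.integrable_of_hasCompactSupport
        ((hDc w).comp hcont)
        (hasCompactSupport_comp_graph (hDs w) hg.continuous τ)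
    have hI2 : Integrable (fun y => fderiv ℝ g y v * fderiv ℝ f (y, g y + τ) (0, 1)) μ := by
      refine (hI (0, 1)).bdd_mul (c := K * ‖v‖) ?_ (.of_forall fun y => ?_)
      · exact (measurable_fderiv_apply_const ℝ g v).aestronglyMeasurable
      · exact ((fderiv ℝ g y).le_opNorm v).trans
          (by gcongr; exact norm_fderiv_le_of_lipschitz ℝ hg)
    refine eq_neg_of_add_eq_zero_left ?_
    rw [← integral_add (hI _) hI2]
    refine Eq.trans ?_ (integral_lineDeriv_eq_zero (μ := μ) hL hS v)
    refine integral_congr_ae ?_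
    filter_upwards [hg.ae_differentiableAt (μ := μ)] with y hy
    have h1 : HasFDerivAt (fun y => (y, g y + τ))
        ((ContinuousLinearMap.id ℝ E).prod (fderiv ℝ g y)) y :=
      (hasFDerivAt_id y).prodMk (hy.hasFDerivAt.add_const τ)
    have h2 := (hf.differentiable one_ne_zero (y, g y + τ)).hasFDerivAt.comp y h1
    change _ = lineDeriv ℝ (f ∘ fun y => (y, g y + τ)) y v
    rw [(h2.hasLineDerivAt v).lineDeriv]
    have : ((v, fderiv ℝ g y v) : E × ℝ) = (v, 0) + fderiv ℝ g y v • (0, 1) := by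
      simp
    simp only [ContinuousLinearMap.comp_apply, ContinuousLinearMap.prod_apply,
      ContinuousLinearMap.id_apply]
    rw [this, map_add, map_smul, smul_eq_mul]
  calc ∫ y, (∫ τ in Iio (g y), fderiv ℝ f (y, τ) (v, 0)) ∂μ
      = ∫ y, (∫ τ in Iio 0, fderiv ℝ f (y, g y + τ) (v, 0)) ∂μ := by
        exact integral_congr_ae (.of_forall fun y =>
          (setIntegral_Iio_comp_add (g y) (fun τ => fderiv ℝ f (y, τ) (v, 0))).symm)
    _ = ∫ τ in Iio 0, ∫ y, fderiv ℝ f (y, g y + τ) (v, 0) ∂μ := integral_integral_swap (hint _)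
    _ = ∫ τ in Iio 0, - ∫ y, fderiv ℝ g y v * fderiv ℝ f (y, g y + τ) (0, 1) ∂μ := by
        simp_rw [key]
    _ = - ∫ y, (∫ τ in Iio 0, fderiv ℝ g y v * fderiv ℝ f (y, g y + τ) (0, 1)) ∂μ := by
        rw [integral_neg, ← integral_integral_swap (μ := μ)]; exact hint2
    _ = _ := by
        congr 1
        refine integral_congr_ae (.of_forall fun y => ?_)
        simp only
        rw [integral_const_mul, setIntegral_Iio_comp_add (g y) (fun τ => fderiv ℝ f (y, τ) (0, 1)),
          setIntegral_Iio_fderiv_vertical hf hfc]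

end Subgraph

/-! ### Smooth partitions of unity -/

theorem exists_finite_smooth_partition {K : Set E3} (hK : IsCompact K) (r : E3 → ℝ)
    (hr : ∀ x, 0 < r x) :
    ∃ (t : Finset E3) (χ : t → E3 → ℝ), (∀ i, ContDiff ℝ ∞ (χ i)) ∧
      (∀ i, tsupport (χ i) ⊆ Metric.ball (i : E3) (r i)) ∧ ∀ x ∈ K, ∑ i, χ i x = 1 := by
  obtain ⟨t, -, ht⟩ := hK.elim_nhds_subcover (fun x => Metric.ball x (r x))
    (fun x _ => Metric.ball_mem_nhds x (hr x))
  have hcov : K ⊆ ⋃ i : t, Metric.ball (i : E3) (r i) := by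
    intro x hx
    obtain ⟨i, hi, hxi⟩ := mem_iUnion₂.1 (ht hx)
    exact mem_iUnion.2 ⟨⟨i, hi⟩, hxi⟩
  obtain ⟨f, hf⟩ := SmoothPartitionOfUnity.exists_isSubordinate (modelWithCornersSelf ℝ E3)
    hK.isClosed (fun i : t => Metric.ball (i : E3) (r i)) (fun _ => Metric.isOpen_ball) hcov
  refine ⟨t, fun i => f i, fun i => (f i).contMDiff.contDiff, hf, fun x hx => ?_⟩
  rw [← finsum_eq_sum_of_fintype]
  exact f.sum_eq_one hx

/-! ### Coordinates adapted to a graph -/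

/-- The Euclidean plane. -/
abbrev E2 : Type := EuclideanSpace ℝ (Fin 2)

/-- The identification of `ℝ² × ℝ` with `ℝ³`. -/
noncomputable def stdChart : (E2 × ℝ) ≃L[ℝ] E3 :=
  LinearEquiv.toContinuousLinearEquiv
    { toFun := fun p => !₂[p.1 0, p.1 1, p.2]
      invFun := fun z => (!₂[z 0, z 1], z 2)
      map_add' := fun p q => by ext i; fin_cases i <;> simp
      map_smul' := fun a p => by ext i; fin_cases i <;> simp
      left_inv := fun p => by
        refine Prod.ext ?_ ?_
        · ext i; fin_cases i <;> simp
        · simp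
      right_inv := fun z => by ext i; fin_cases i <;> simp }

theorem stdChart_apply (p : E2 × ℝ) : stdChart p = !₂[p.1 0, p.1 1, p.2] := rfl

theorem inner_stdChart (p q : E2 × ℝ) :
    inner ℝ (stdChart p) (stdChart q) = inner ℝ p.1 q.1 + p.2 * q.2 := by
  simp [stdChart_apply, PiLp.inner_apply, Fin.sum_univ_three, Fin.sum_univ_two, mul_comm]

theorem measurePreserving_stdChart :
    MeasurePreserving (stdChart : E2 × ℝ → E3) volume volume := by
  -- The swap is needed because `piFinSuccAbove` at index `2` lists the last coordinate first.
  have h1 : MeasurePreserving (fun p : E2 × ℝ => (p.2, p.1.ofLp)) volume volume :=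
    (Measure.measurePreserving_swap (μ := (volume : Measure (Fin 2 → ℝ)))
      (ν := (volume : Measure ℝ))).comp
      ((PiLp.volume_preserving_ofLp (Fin 2)).prod (MeasurePreserving.id (volume : Measure ℝ)))
  have h2 := (volume_preserving_piFinSuccAbove (fun _ : Fin 3 => ℝ) 2).symm
  have h3 := (PiLp.volume_preserving_toLp (Fin 3)).comp (h2.comp h1)
  have hfun : (stdChart : E2 × ℝ → E3) = WithLp.toLp 2 ∘
      (MeasurableEquiv.piFinSuccAbove (fun _ : Fin 3 => ℝ) 2).symm ∘
        fun p : E2 × ℝ => (p.2, p.1.ofLp) := by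
    funext p
    ext i
    fin_cases i <;> rfl
  rw [hfun]
  exact h3

/-- Rotated coordinates on `ℝ³`. -/
noncomputable def rotChart (e : E3 ≃ₗᵢ[ℝ] E3) : (E2 × ℝ) ≃L[ℝ] E3 :=
  stdChart.trans e.symm.toContinuousLinearEquiv

theorem rotChart_apply (e : E3 ≃ₗᵢ[ℝ] E3) (p : E2 × ℝ) :
    rotChart e p = e.symm (stdChart p) := rfl

theorem inner_rotChart (e : E3 ≃ₗᵢ[ℝ] E3) (p q : E2 × ℝ) :
    inner ℝ (rotChart e p) (rotChart e q) = inner ℝ p.1 q.1 + p.2 * q.2 := by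
  rw [rotChart_apply, rotChart_apply, LinearIsometryEquiv.inner_map_map, inner_stdChart]

theorem norm_rotChart_sq (e : E3 ≃ₗᵢ[ℝ] E3) (p : E2 × ℝ) :
    ‖rotChart e p‖ ^ 2 = ‖p.1‖ ^ 2 + p.2 ^ 2 := by
  rw [← real_inner_self_eq_norm_sq, inner_rotChart, real_inner_self_eq_norm_sq, sq p.2]

theorem measurePreserving_rotChart (e : E3 ≃ₗᵢ[ℝ] E3) :
    MeasurePreserving (rotChart e : E2 × ℝ → E3) volume volume :=
  e.symm.measurePreserving.comp measurePreserving_stdChart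

theorem measurableEmbedding_rotChart (e : E3 ≃ₗᵢ[ℝ] E3) :
    MeasurableEmbedding (rotChart e : E2 × ℝ → E3) :=
  (rotChart e).toHomeomorph.measurableEmbedding

/-- The parametrization of the graph of `g` in rotated coordinates. -/
noncomputable def graphPoint (e : E3 ≃ₗᵢ[ℝ] E3) (g : E2 → ℝ) (y : E2) : E3 := rotChart e (y, g y)

theorem isGraphMap_graphPoint (e : E3 ≃ₗᵢ[ℝ] E3) (g : E2 → ℝ) : IsGraphMap g (graphPoint e g) := by
  intro x y
  rw [dist_eq_norm, graphPoint, graphPoint, ← map_sub, norm_rotChart_sq]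
  rfl

/-- The upward normal of the graph of `g`, of length the area factor. -/
noncomputable def graphNormal (e : E3 ≃ₗᵢ[ℝ] E3) (g : E2 → ℝ) (y : E2) : E3 :=
  rotChart e (-gradient g y, 1)

theorem norm_graphNormal (e : E3 ≃ₗᵢ[ℝ] E3) (g : E2 → ℝ) (y : E2) :
    ‖graphNormal e g y‖ = areaFactor (gradient g y) := by
  rw [areaFactor, ← Real.sqrt_sq (norm_nonneg (graphNormal e g y)), graphNormal, norm_rotChart_sq]
  simp [add_comm]

/-- Near `x`, in the rotated coordinates `e`, the set `Ω` is the subgraph of `g`. -/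
def IsSubgraphNear (Ω : Set E3) (x : E3) (r : ℝ) (e : E3 ≃ₗᵢ[ℝ] E3) (g : E2 → ℝ) : Prop :=
  ∀ p, rotChart e p ∈ Metric.ball x r → (rotChart e p ∈ Ω ↔ p.2 < g p.1)

theorem IsLipschitzDomain.exists_isSubgraphNear {Ω : Set E3} (hΩ : IsLipschitzDomain Ω) {x : E3}
    (hx : x ∈ frontier Ω) : ∃ r > 0, ∃ (e : E3 ≃ₗᵢ[ℝ] E3) (K : ℝ≥0) (g : E2 → ℝ),
      LipschitzWith K g ∧ IsSubgraphNear Ω x r e g := by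
  obtain ⟨r, hr, e, K, g, hg, h⟩ := hΩ.locally_below_graph x hx
  refine ⟨r, hr, e, K, g, hg, fun p hp => ?_⟩
  rw [h _ hp, rotChart_apply, LinearIsometryEquiv.apply_symm_apply, stdChart_apply]
  have : !₂[p.1 0, p.1 1] = p.1 := by ext i; fin_cases i <;> simp
  simp [this]

/-! ### Frontier and outer normal of a set that is locally a subgraph. -/

section Local

variable {Ω : Set E3} {x : E3} {r : ℝ} {e : E3 ≃ₗᵢ[ℝ] E3} {g : E2 → ℝ}

/-- A point strictly above the graph has a neighbourhood missing `Ω`, while a point on the graph is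
the limit of the points vertically below it. -/
theorem IsSubgraphNear.mem_frontier_iff (h : IsSubgraphNear Ω x r e g) (hΩ : IsOpen Ω)
    (hg : Continuous g) {p : E2 × ℝ} (hp : rotChart e p ∈ Metric.ball x r) :
    rotChart e p ∈ frontier Ω ↔ p.2 = g p.1 := by
  rw [hΩ.frontier_eq, Set.mem_sdiff, h p hp]
  have hball : ∀ᶠ q in 𝓝 p, rotChart e q ∈ Metric.ball x r :=
    (rotChart e).continuous.continuousAt.eventually (Metric.isOpen_ball.mem_nhds hp)
  constructor
  · rintro ⟨h1, h2⟩
    by_contra h3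
    have hlt : g p.1 < p.2 := lt_of_le_of_ne (not_lt.1 h2) (Ne.symm h3)
    have hopen : ∀ᶠ q : E2 × ℝ in 𝓝 p, g q.1 < q.2 :=
      (isOpen_lt (hg.comp continuous_fst) continuous_snd).mem_nhds hlt
    have hnot : ∀ᶠ q in 𝓝 p, rotChart e q ∉ Ω := by
      filter_upwards [hball, hopen] with q hq1 hq2 hq3
      exact absurd ((h q hq1).1 hq3) (not_lt.2 hq2.le)
    have hnot' : ∀ᶠ z in 𝓝 (rotChart e p), z ∉ Ω := by
      have h4 := (rotChart e).symm.continuous.tendsto (rotChart e p)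
      rw [ContinuousLinearEquiv.symm_apply_apply] at h4
      simpa using h4.eventually hnot
    exact (mem_closure_iff_frequently.1 h1) (by simpa using hnot')
  · intro h1
    refine ⟨?_, by rw [h1]; exact lt_irrefl _⟩
    have hlim : Tendsto (fun s : ℝ => rotChart e (p.1, p.2 - s)) (𝓝[>] 0) (𝓝 (rotChart e p)) := by
      have : Continuous (fun s : ℝ => rotChart e (p.1, p.2 - s)) :=
        (rotChart e).continuous.comp (by fun_prop)
      have h2 := this.tendsto 0
      simp only [sub_zero, Prod.mk.eta] at h2
      exact h2.mono_left nhdsWithin_le_nhds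
    refine mem_closure_of_tendsto hlim ?_
    filter_upwards [hlim.eventually (Metric.isOpen_ball.mem_nhds hp), self_mem_nhdsWithin]
      with s hs1 hs2
    rw [h _ hs1]
    simp only [mem_Ioi] at hs2
    simp only
    linarith

/-- Differentiability keeps the graph within `ε ‖v - y‖` of its tangent plane. A cone of opening `ε`
around the normalized normal clears this error because the area factor is at least `1` and
projection to the plane does not increase length. -/
theorem IsSubgraphNear.isOuterNormal (h : IsSubgraphNear Ω x r e g) {y : E2}
    (hy : DifferentiableAt ℝ g y) (hball : graphPoint e g y ∈ Metric.ball x r) :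
    IsOuterNormal Ω (graphPoint e g y) ((areaFactor (gradient g y))⁻¹ • graphNormal e g y) := by
  have hJ := one_le_areaFactor (gradient g y)
  have hJ0 : 0 < areaFactor (gradient g y) := by linarith
  refine ⟨?_, fun ε hε => ?_⟩
  · rw [norm_smul, norm_graphNormal, norm_inv, Real.norm_of_nonneg hJ0.le,
      inv_mul_cancel₀ hJ0.ne']
  have hd : ∀ᶠ v in 𝓝 y, |g v - g y - inner ℝ (gradient g y) (v - y)| ≤ ε * ‖v - y‖ := by
    have := hy.hasFDerivAt.isLittleO.def hε
    filter_upwards [this] with v hv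
    rw [gradient, InnerProductSpace.toDual_symm_apply]
    simpa using hv
  have hproj : Tendsto (fun z => ((rotChart e).symm z).1) (𝓝 (graphPoint e g y)) (𝓝 y) := by
    have : Continuous (fun z => ((rotChart e).symm z).1) :=
      continuous_fst.comp (rotChart e).symm.continuous
    simpa [graphPoint] using this.tendsto (graphPoint e g y)
  filter_upwards [hproj.eventually hd, Metric.isOpen_ball.mem_nhds hball] with z hz hzb
  obtain ⟨p, rfl⟩ := (rotChart e).surjective z
  simp only [ContinuousLinearEquiv.symm_apply_apply] at hz
  rw [h p hzb]
  have hdiff : rotChart e p - graphPoint e g y = rotChart e (p.1 - y, p.2 - g y) := by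
    rw [graphPoint, ← map_sub]; rfl
  have hin : inner ℝ ((areaFactor (gradient g y))⁻¹ • graphNormal e g y)
      (rotChart e p - graphPoint e g y) = (areaFactor (gradient g y))⁻¹ *
        (p.2 - g y - inner ℝ (gradient g y) (p.1 - y)) := by
    rw [hdiff, real_inner_smul_left, graphNormal, inner_rotChart, inner_neg_left]
    ring
  have hnorm : ‖p.1 - y‖ ≤ ‖rotChart e p - graphPoint e g y‖ := by
    apply le_of_sq_le_sq _ (norm_nonneg _)
    rw [hdiff, norm_rotChart_sq]
    nlinarith [sq_nonneg (p.2 - g y)]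
  rw [hin]
  set N := ‖rotChart e p - graphPoint e g y‖
  set J := areaFactor (gradient g y)
  have hN : ε * ‖p.1 - y‖ ≤ J * (ε * N) := by
    have : ε * ‖p.1 - y‖ ≤ ε * N := by gcongr
    have h0 : 0 ≤ ε * N := by positivity
    nlinarith
  have hz' := abs_le.1 hz
  constructor
  · intro h1
    rw [inv_mul_lt_iff₀ hJ0] at h1
    linarith [hz'.1]
  · intro h1
    rw [lt_inv_mul_iff₀ hJ0] at h1
    linarith [hz'.2]

end Local

theorem IsOuterNormal.unique {Ω : Set E3} {x n₁ n₂ : E3} (h₁ : IsOuterNormal Ω x n₁)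
    (h₂ : IsOuterNormal Ω x n₂) : n₁ = n₂ := by
  by_contra hne
  have hlt : inner ℝ n₁ n₂ < 1 := (inner_lt_one_iff_real_of_norm_eq_one h₁.1 h₂.1).2 hne
  set v := n₂ - n₁
  have hv : 0 < ‖v‖ := norm_pos_iff.2 (sub_ne_zero.2 (Ne.symm hne))
  set β := 1 - inner ℝ n₁ n₂ with hβ
  have h1v : inner ℝ n₁ v = -β := by
    rw [inner_sub_right, real_inner_self_eq_norm_sq, h₁.1]; simp [hβ]
  have h2v : inner ℝ n₂ v = β := by
    rw [inner_sub_right, real_inner_self_eq_norm_sq, h₂.1, real_inner_comm]; simp [hβ]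
  have hβ0 : 0 < β := by simp only [hβ]; linarith
  -- Half the slope `β / ‖v‖` of `v` relative to both normals: a short step along `v = n₂ - n₁` then
  -- lies in the inner cone of `n₁` and in the outer cone of `n₂`, a contradiction.
  have hε : 0 < β / (2 * ‖v‖) := by positivity
  have hlim : Tendsto (fun s : ℝ => x + s • v) (𝓝[>] 0) (𝓝 x) := by
    have : Continuous (fun s : ℝ => x + s • v) := by fun_prop
    simpa using (this.tendsto 0).mono_left nhdsWithin_le_nhds
  obtain ⟨s, hs1, hs2, hs0⟩ := ((hlim.eventually (h₁.2 _ hε)).and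
    ((hlim.eventually (h₂.2 _ hε)).and self_mem_nhdsWithin)).exists
  replace hs0 : 0 < s := hs0
  have hε2 : β / (2 * ‖v‖) * ‖x + s • v - x‖ = s * β / 2 := by
    rw [add_sub_cancel_left, norm_smul, Real.norm_of_nonneg hs0.le]
    field_simp
  have hsβ : 0 < s * β := by positivity
  refine hs2.2 ?_ (hs1.1 ?_)
  · rw [hε2, add_sub_cancel_left, inner_smul_right, h2v]; linarith
  · rw [neg_mul, hε2, add_sub_cancel_left, inner_smul_right, h1v]; linarith

theorem IsOuterNormal.outerNormal_eq {Ω : Set E3} {x n : E3} (h : IsOuterNormal Ω x n) :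
    outerNormal Ω x = n := by
  have hex : ∃ n, IsOuterNormal Ω x n := ⟨n, h⟩
  rw [outerNormal, dif_pos hex]
  exact hex.choose_spec.unique h

/-! ### The divergence theorem -/

/-- The divergence of a differentiable vector field. -/
noncomputable def divergence (F : E3 → E3) (x : E3) : ℝ := ∑ i, partialD F i i x

/-- The divergence is the trace of the derivative, so it can be computed in the rotated coordinates
of a chart. -/
theorem divergence_eq_sum_orthonormalBasis (F : E3 → E3) (x : E3)
    (b : OrthonormalBasis (Fin 3) ℝ E3) :
    divergence F x = ∑ i, inner ℝ (b i) (fderiv ℝ F x (b i)) := by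
  have h1 := LinearMap.trace_eq_sum_inner (fderiv ℝ F x : E3 →ₗ[ℝ] E3) b
  have h2 := LinearMap.trace_eq_sum_inner (fderiv ℝ F x : E3 →ₗ[ℝ] E3)
    (EuclideanSpace.basisFun (Fin 3) ℝ)
  rw [h1] at h2
  simp only [ContinuousLinearMap.coe_coe] at h2
  rw [h2, divergence]
  refine Finset.sum_congr rfl fun i _ => ?_
  simp [partialD, EuclideanSpace.inner_single_left]

theorem continuous_divergence {F : E3 → E3} (hF : ContDiff ℝ 1 F) : Continuous (divergence F) := by
  have := hF.continuous_fderiv one_ne_zero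
  unfold divergence partialD
  fun_prop

theorem divergence_eq_zero_of_notMem {F : E3 → E3} {x : E3} (hx : x ∉ tsupport F) :
    divergence F x = 0 := by
  simp [divergence, partialD, fderiv_of_notMem_tsupport ℝ hx]

theorem hasCompactSupport_divergence {F : E3 → E3} (hF : HasCompactSupport F) :
    HasCompactSupport (divergence F) :=
  HasCompactSupport.intro hF fun _ hx => divergence_eq_zero_of_notMem hx

theorem divergence_sum {ι : Type*} (t : Finset ι) (F : ι → E3 → E3)
    (hF : ∀ i, Differentiable ℝ (F i)) (x : E3) :
    divergence (fun x => ∑ i ∈ t, F i x) x = ∑ i ∈ t, divergence (F i) x := by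
  unfold divergence partialD
  rw [Finset.sum_comm]
  refine Finset.sum_congr rfl fun j _ => ?_
  rw [fderiv_fun_sum fun i _ => hF i x]
  simp

theorem integral_divergence_eq_zero {F : E3 → E3} (hF : ContDiff ℝ 1 F)
    (hc : HasCompactSupport F) : ∫ x, divergence F x = 0 := by
  have hD : ∀ i, Continuous fun x => partialD F i i x := fun i => by
    have := hF.continuous_fderiv one_ne_zero
    unfold partialD
    fun_prop
  have hS : ∀ i, HasCompactSupport fun x => partialD F i i x := fun i =>
    HasCompactSupport.intro hc fun x hx => by simp [partialD, fderiv_of_notMem_tsupport ℝ hx]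
  unfold divergence
  rw [integral_finsetSum _ fun i _ => (hD i).integrable_of_hasCompactSupport (hS i)]
  refine Finset.sum_eq_zero fun i _ => ?_
  have h1 : ContDiff ℝ 1 fun x => F x i := by fun_prop
  have h2 : HasCompactSupport fun x => F x i := hc.comp_left (g := fun z : E3 => z i) rfl
  obtain ⟨C, hC⟩ := h1.lipschitzWith_of_hasCompactSupport h2 one_ne_zero
  rw [← integral_lineDeriv_eq_zero (μ := volume) hC h2 (EuclideanSpace.single i 1)]
  congr 1
  funext x
  have h3 := (EuclideanSpace.proj (𝕜 := ℝ) i).hasFDerivAt.comp x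
    (hF.differentiable one_ne_zero x).hasFDerivAt
  exact (h3.hasLineDerivAt (EuclideanSpace.single i 1)).lineDeriv.symm

/-! ### The divergence theorem for fields supported in one chart. -/

section Local

variable {Ω : Set E3} {x : E3} {r : ℝ} {e : E3 ≃ₗᵢ[ℝ] E3} {g : E2 → ℝ} {K : ℝ≥0} {F : E3 → E3}

/-- The component of `F ∘ rotChart e` along the coordinate direction `w`. -/
noncomputable def chartComponent (e : E3 ≃ₗᵢ[ℝ] E3) (F : E3 → E3) (w p : E2 × ℝ) : ℝ :=
  inner ℝ (rotChart e w) (F (rotChart e p))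

theorem contDiff_chartComponent (hF : ContDiff ℝ 1 F) (w : E2 × ℝ) :
    ContDiff ℝ 1 (chartComponent e F w) := by
  have := (rotChart e).contDiff (n := 1)
  exact contDiff_const.inner ℝ (hF.comp this)

theorem hasCompactSupport_chartComponent (hF : HasCompactSupport F) (w : E2 × ℝ) :
    HasCompactSupport (chartComponent e F w) :=
  (hF.comp_homeomorph (rotChart e).toHomeomorph).comp_left
    (g := fun z => inner ℝ (rotChart e w) z) (inner_zero_right _)

theorem fderiv_chartComponent (hF : ContDiff ℝ 1 F) (w p q : E2 × ℝ) :
    fderiv ℝ (chartComponent e F w) p q =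
      inner ℝ (rotChart e w) (fderiv ℝ F (rotChart e p) (rotChart e q)) := by
  have h1 := (hF.differentiable one_ne_zero (rotChart e p)).hasFDerivAt.comp p
    (rotChart e).hasFDerivAt
  have h2 := (innerSL ℝ (rotChart e w)).hasFDerivAt.comp p h1
  have h3 : fderiv ℝ (chartComponent e F w) p = _ := h2.fderiv
  rw [h3]
  rfl

theorem divergence_rotChart (hF : ContDiff ℝ 1 F) (p : E2 × ℝ) :
    divergence F (rotChart e p) =
      fderiv ℝ (chartComponent e F (EuclideanSpace.single 0 1, 0)) p (EuclideanSpace.single 0 1, 0)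
      + fderiv ℝ (chartComponent e F (EuclideanSpace.single 1 1, 0)) p
          (EuclideanSpace.single 1 1, 0)
      + fderiv ℝ (chartComponent e F (0, 1)) p (0, 1) := by
  rw [divergence_eq_sum_orthonormalBasis F _ ((EuclideanSpace.basisFun (Fin 3) ℝ).map e.symm),
    Fin.sum_univ_three, fderiv_chartComponent hF, fderiv_chartComponent hF,
    fderiv_chartComponent hF]
  have h0 : rotChart e (EuclideanSpace.single 0 1, 0) = e.symm (EuclideanSpace.single 0 1) := by
    rw [rotChart_apply]; congr 1; ext i; fin_cases i <;> simp [stdChart_apply]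
  have h1 : rotChart e (EuclideanSpace.single 1 1, 0) = e.symm (EuclideanSpace.single 1 1) := by
    rw [rotChart_apply]; congr 1; ext i; fin_cases i <;> simp [stdChart_apply]
  have h2 : rotChart e (0, 1) = e.symm (EuclideanSpace.single 2 1) := by
    rw [rotChart_apply]; congr 1; ext i; fin_cases i <;> simp [stdChart_apply]
  simp only [h0, h1, h2, OrthonormalBasis.map_apply, EuclideanSpace.basisFun_apply]

theorem inner_graphNormal (y : E2) (z : E3) :
    inner ℝ (graphNormal e g y) z =
      inner ℝ (rotChart e (0, 1)) z
      - fderiv ℝ g y (EuclideanSpace.single 0 1) *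
          inner ℝ (rotChart e (EuclideanSpace.single 0 1, 0)) z
      - fderiv ℝ g y (EuclideanSpace.single 1 1) *
          inner ℝ (rotChart e (EuclideanSpace.single 1 1, 0)) z := by
  have hv : ((-gradient g y, 1) : E2 × ℝ) = (0, 1)
      - fderiv ℝ g y (EuclideanSpace.single 0 1) • (EuclideanSpace.single 0 1, 0)
      - fderiv ℝ g y (EuclideanSpace.single 1 1) • (EuclideanSpace.single 1 1, 0) := by
    have hg : ∀ v, fderiv ℝ g y v = inner ℝ (gradient g y) v := fun v => by
      rw [gradient, InnerProductSpace.toDual_symm_apply]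
    have hgi : ∀ i, fderiv ℝ g y (EuclideanSpace.single i 1) = gradient g y i := fun i => by
      rw [hg, real_inner_comm, EuclideanSpace.inner_single_left, map_one, one_mul]
    refine Prod.ext ?_ ?_
    · ext i
      fin_cases i <;> simp [hgi]
    · simp
  rw [graphNormal, hv, map_sub, map_sub, map_smul, map_smul, inner_sub_left, inner_sub_left,
    real_inner_smul_left, real_inner_smul_left]

theorem integrable_inner_graphNormal (hg : LipschitzWith K g) (hF : ContDiff ℝ 1 F)
    (hc : HasCompactSupport F) :
    (∀ w, Integrable fun y => chartComponent e F w (y, g y)) ∧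
    (∀ v w, Integrable fun y => fderiv ℝ g y v * chartComponent e F w (y, g y)) := by
  have h1 : ∀ w, Integrable fun y => chartComponent e F w (y, g y) := fun w => by
    have hgc := hg.continuous
    refine Continuous.integrable_of_hasCompactSupport
      ((contDiff_chartComponent hF w).continuous.comp (by fun_prop)) ?_
    simpa using hasCompactSupport_comp_graph (hasCompactSupport_chartComponent hc w) hgc 0
  refine ⟨h1, fun v w => (h1 w).bdd_mul (c := K * ‖v‖) ?_ (.of_forall fun y => ?_)⟩
  · exact (measurable_fderiv_apply_const ℝ g v).aestronglyMeasurable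
  · exact ((fderiv ℝ g y).le_opNorm v).trans (by gcongr; exact norm_fderiv_le_of_lipschitz ℝ hg)

/-- The vertical derivative contributes the vertical component of `F` on the graph, and each
horizontal one contributes minus a slope of `g` times a component. Together they pair `F` with
`(-∇g, 1)`. -/
theorem setIntegral_subgraph_divergence (hg : LipschitzWith K g) (hF : ContDiff ℝ 1 F)
    (hc : HasCompactSupport F) :
    ∫ p in {p : E2 × ℝ | p.2 < g p.1}, divergence F (rotChart e p) =
      ∫ y, inner ℝ (graphNormal e g y) (F (graphPoint e g y)) := by
  have hgc := hg.continuous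
  have hmeas : MeasurableSet {p : E2 × ℝ | p.2 < g p.1} :=
    (isOpen_lt continuous_snd (hgc.comp continuous_fst)).measurableSet
  have key : ∀ w q, Integrable (fun p => fderiv ℝ (chartComponent e F w) p q) ∧
      ∫ p in {p : E2 × ℝ | p.2 < g p.1}, fderiv ℝ (chartComponent e F w) p q =
      ∫ y, ∫ τ in Iio (g y), fderiv ℝ (chartComponent e F w) (y, τ) q := by
    intro w q
    have hint : Integrable (fun p => fderiv ℝ (chartComponent e F w) p q) :=
      Continuous.integrable_of_hasCompactSupport
        (((contDiff_chartComponent hF w).continuous_fderiv one_ne_zero).clm_apply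
          continuous_const)
        ((hasCompactSupport_chartComponent hc w).fderiv_apply ℝ q)
    refine ⟨hint, ?_⟩
    rw [← integral_indicator hmeas, Measure.volume_eq_prod,
      integral_prod _ (hint.indicator hmeas)]
    refine integral_congr_ae (.of_forall fun y => ?_)
    simp only
    rw [← integral_indicator measurableSet_Iio]
    rfl
  obtain ⟨hI1, hI2⟩ := integrable_inner_graphNormal (e := e) hg hF hc
  have hC := fun w => contDiff_chartComponent (e := e) hF w
  have hS := fun w => hasCompactSupport_chartComponent (e := e) hc w
  simp_rw [divergence_rotChart hF]
  have hadd : ∀ w₁ w₂, Integrable (fun p => fderiv ℝ (chartComponent e F w₁) p w₁ +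
      fderiv ℝ (chartComponent e F w₂) p w₂) := fun w₁ w₂ => (key w₁ w₁).1.add (key w₂ w₂).1
  rw [integral_add (hadd _ _).integrableOn (key _ _).1.integrableOn,
    integral_add (key _ _).1.integrableOn (key _ _).1.integrableOn, (key _ _).2, (key _ _).2,
    (key _ _).2, integral_subgraph_fderiv_horizontal (hC _) (hS _) hg,
    integral_subgraph_fderiv_horizontal (hC _) (hS _) hg]
  simp_rw [setIntegral_Iio_fderiv_vertical (hC _) (hS _), inner_graphNormal]
  have hcomp : ∀ w y, inner ℝ (rotChart e w) (F (graphPoint e g y)) =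
    chartComponent e F w (y, g y) := fun _ _ => rfl
  simp_rw [hcomp]
  have hsub : ∀ v w, Integrable (fun y => chartComponent e F (0, 1) (y, g y) -
      fderiv ℝ g y v * chartComponent e F w (y, g y)) := fun v w => (hI1 _).sub (hI2 v w)
  rw [integral_sub (hsub _ _) (hI2 _ _), integral_sub (hI1 _) (hI2 _ _)]
  ring

/-- The area element equals the length of `graphNormal`, so it cancels the normalization of the
outer normal at almost every parameter. Since `F` vanishes off the ball, `frontier Ω` and `Ω` may be
replaced by the whole graph and the whole subgraph. -/
theorem IsSubgraphNear.divergence_theorem (h : IsSubgraphNear Ω x r e g) (hΩ : IsOpen Ω)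
    (hg : LipschitzWith K g) (hF : ContDiff ℝ 1 F) (hc : HasCompactSupport F)
    (hs : tsupport F ⊆ Metric.ball x r) :
    IntegrableOn (fun z => inner ℝ (F z) (outerNormal Ω z)) (frontier Ω) μHE[2] ∧
      ∫ z in frontier Ω, inner ℝ (F z) (outerNormal Ω z) ∂μHE[2] = ∫ z in Ω, divergence F z := by
  have hΨ := isGraphMap_graphPoint e g
  have hrange : MeasurableSet (range (graphPoint e g)) :=
    (hΨ.isClosedEmbedding hg).isClosed_range.measurableSet
  have hF0 : ∀ z, z ∉ Metric.ball x r → F z = 0 := fun z hz =>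
    image_eq_zero_of_notMem_tsupport fun h => hz (hs h)
  have hmem : ∀ z ∈ Metric.ball x r, (z ∈ frontier Ω ↔ z ∈ range (graphPoint e g)) := by
    intro z hz
    obtain ⟨p, rfl⟩ := (rotChart e).surjective z
    rw [h.mem_frontier_iff hΩ hg.continuous hz]
    constructor
    · intro hp; exact ⟨p.1, by rw [graphPoint, ← hp]⟩
    · rintro ⟨y, hy⟩
      rw [← (rotChart e).injective hy]
  have hind : (frontier Ω).indicator (fun z => inner ℝ (F z) (outerNormal Ω z)) =
      (range (graphPoint e g)).indicator (fun z => inner ℝ (F z) (outerNormal Ω z)) := by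
    funext z
    by_cases hz : z ∈ Metric.ball x r
    · by_cases hz2 : z ∈ frontier Ω
      · rw [indicator_of_mem hz2, indicator_of_mem ((hmem z hz).1 hz2)]
      · rw [indicator_of_notMem hz2, indicator_of_notMem fun h' => hz2 ((hmem z hz).2 h')]
    · simp [indicator, hF0 z hz]
  have hae : (fun y => areaFactor (gradient g y) *
      inner ℝ (F (graphPoint e g y)) (outerNormal Ω (graphPoint e g y))) =ᵐ[volume]
      fun y => inner ℝ (graphNormal e g y) (F (graphPoint e g y)) := by
    filter_upwards [hg.ae_differentiableAt (μ := volume)] with y hy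
    by_cases hz : graphPoint e g y ∈ Metric.ball x r
    · have hJ := one_le_areaFactor (gradient g y)
      rw [(h.isOuterNormal hy hz).outerNormal_eq, inner_smul_right, real_inner_comm,
        ← mul_assoc, mul_inv_cancel₀ (by linarith), one_mul]
    · simp [hF0 _ hz]
  constructor
  · rw [← integrable_indicator_iff isClosed_frontier.measurableSet, hind,
      integrable_indicator_iff hrange, hΨ.integrableOn_range_iff hg, integrable_congr hae]
    simp_rw [inner_graphNormal]
    obtain ⟨hI1, hI2⟩ := integrable_inner_graphNormal (e := e) hg hF hc
    exact ((hI1 _).sub (hI2 _ _)).sub (hI2 _ _)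
  · rw [← integral_indicator isClosed_frontier.measurableSet, hind, integral_indicator hrange,
      hΨ.setIntegral_range hg, integral_congr_ae hae, ← setIntegral_subgraph_divergence hg hF hc,
      ← (measurePreserving_rotChart e).setIntegral_preimage_emb (measurableEmbedding_rotChart e)]
    have hm1 : MeasurableSet {p : E2 × ℝ | p.2 < g p.1} :=
      (isOpen_lt continuous_snd (hg.continuous.comp continuous_fst)).measurableSet
    have hm2 : MeasurableSet (rotChart e ⁻¹' Ω) :=
      (hΩ.preimage (rotChart e).continuous).measurableSet
    rw [← integral_indicator hm1, ← integral_indicator hm2]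
    congr 1
    funext p
    by_cases hz : rotChart e p ∈ Metric.ball x r
    · have := h p hz
      by_cases hp : p.2 < g p.1
      · rw [indicator_of_mem (show p ∈ {p : E2 × ℝ | p.2 < g p.1} from hp),
          indicator_of_mem (show p ∈ rotChart e ⁻¹' Ω from this.2 hp)]
      · rw [indicator_of_notMem (show p ∉ {p : E2 × ℝ | p.2 < g p.1} from hp),
          indicator_of_notMem (show p ∉ rotChart e ⁻¹' Ω from fun h' => hp (this.1 h'))]
    · simp [indicator, divergence_eq_zero_of_notMem fun h' => hz (hs h')]

end Local

/-- Around interior points there is no boundary contribution and the divergence integrates to zero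
over space; around exterior points both sides vanish; at frontier points the chart version applies.
-/
theorem IsLipschitzDomain.exists_local_divergence_theorem {Ω : Set E3} (hΩ : IsLipschitzDomain Ω)
    (x : E3) : ∃ r > 0, ∀ F : E3 → E3, ContDiff ℝ 1 F → HasCompactSupport F →
      tsupport F ⊆ Metric.ball x r →
      IntegrableOn (fun z => inner ℝ (F z) (outerNormal Ω z)) (frontier Ω) μHE[2] ∧
      ∫ z in frontier Ω, inner ℝ (F z) (outerNormal Ω z) ∂μHE[2] = ∫ z in Ω, divergence F z := by
  have zero_on : ∀ F : E3 → E3, (∀ z ∈ frontier Ω, F z = 0) →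
      IntegrableOn (fun z => inner ℝ (F z) (outerNormal Ω z)) (frontier Ω) μHE[2] ∧
      ∫ z in frontier Ω, inner ℝ (F z) (outerNormal Ω z) ∂μHE[2] = 0 := by
    intro F hF
    have hEq : EqOn (fun z => inner ℝ (F z) (outerNormal Ω z)) 0 (frontier Ω) := fun z hz => by
      simp [hF z hz]
    have hm : MeasurableSet (frontier Ω) := isClosed_frontier.measurableSet
    exact ⟨(integrableOn_congr_fun hEq hm).2 integrableOn_zero, by
      rw [setIntegral_congr_fun hm hEq]; simp⟩
  by_cases hx1 : x ∈ Ω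
  · obtain ⟨r, hr, hb⟩ := Metric.isOpen_iff.1 hΩ.isOpen x hx1
    refine ⟨r, hr, fun F hF hc hs => ?_⟩
    have h0 := zero_on F fun z hz => image_eq_zero_of_notMem_tsupport fun h => by
      rw [hΩ.isOpen.frontier_eq] at hz
      exact hz.2 (hb (hs h))
    refine ⟨h0.1, ?_⟩
    rw [h0.2, setIntegral_eq_integral_of_forall_compl_eq_zero, integral_divergence_eq_zero hF hc]
    exact fun z hz => divergence_eq_zero_of_notMem fun h => hz (hb (hs h))
  by_cases hx2 : x ∈ closure Ω
  · obtain ⟨r, hr, e, K, g, hg, h⟩ := hΩ.exists_isSubgraphNear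
      (show x ∈ frontier Ω by rw [hΩ.isOpen.frontier_eq]; exact ⟨hx2, hx1⟩)
    exact ⟨r, hr, fun F hF hc hs => h.divergence_theorem hΩ.isOpen hg hF hc hs⟩
  · obtain ⟨r, hr, hb⟩ := Metric.isOpen_iff.1 isClosed_closure.isOpen_compl x hx2
    refine ⟨r, hr, fun F hF hc hs => ?_⟩
    have h0 := zero_on F fun z hz => image_eq_zero_of_notMem_tsupport fun h =>
      hb (hs h) (frontier_subset_closure hz)
    refine ⟨h0.1, ?_⟩
    rw [h0.2, setIntegral_congr_fun (g := 0) hΩ.isOpen.measurableSet]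
    · simp
    · exact fun z hz => divergence_eq_zero_of_notMem fun h => hb (hs h) (subset_closure hz)

/-- The divergence theorem on a Lipschitz domain for compactly supported `C¹` fields. -/
theorem IsLipschitzDomain.divergence_theorem {Ω : Set E3} (hΩ : IsLipschitzDomain Ω)
    {F : E3 → E3} (hF : IsC1Field F) :
    IntegrableOn (fun z => inner ℝ (F z) (outerNormal Ω z)) (frontier Ω) μHE[2] ∧
      ∫ z in frontier Ω, inner ℝ (F z) (outerNormal Ω z) ∂μHE[2] = ∫ z in Ω, divergence F z := by
  choose r hr hloc using hΩ.exists_local_divergence_theorem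
  obtain ⟨t, χ, hχ, hχs, hχ1⟩ := exists_finite_smooth_partition (K := tsupport F) hF.2 r hr
  have hsum : ∀ z, F z = ∑ i, χ i z • F z := by
    intro z
    by_cases hz : z ∈ tsupport F
    · rw [← Finset.sum_smul, hχ1 z hz, one_smul]
    · simp [image_eq_zero_of_notMem_tsupport hz]
  have hC : ∀ i, ContDiff ℝ 1 fun z => χ i z • F z := fun i =>
    ContDiff.smul ((hχ i).of_le (by simp)) hF.1
  have hS : ∀ i, HasCompactSupport fun z => χ i z • F z := fun i =>
    HasCompactSupport.smul_left (f := χ i) hF.2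
  have hl := fun i : t => hloc i _ (hC i) (hS i)
    ((tsupport_smul_subset_left (χ i) F).trans (hχs i))
  have h1 : (fun z => inner ℝ (F z) (outerNormal Ω z)) =
      fun z => ∑ i, inner ℝ (χ i z • F z) (outerNormal Ω z) := by
    funext z
    conv_lhs => rw [hsum z]
    rw [sum_inner]
  have h2 : ∀ z, divergence F z = ∑ i, divergence (fun z => χ i z • F z) z := by
    intro z
    rw [← divergence_sum _ _ fun i => (hC i).differentiable one_ne_zero]
    congr 1
    funext z
    exact hsum z
  rw [h1]
  refine ⟨integrable_finsetSum _ fun i _ => (hl i).1, ?_⟩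
  simp_rw [h2]
  rw [integral_finsetSum _ fun i _ => (hl i).1, integral_finsetSum _ fun i _ => ?_]
  · exact Finset.sum_congr rfl fun i _ => (hl i).2
  · exact ((continuous_divergence (hC i)).integrable_of_hasCompactSupport
      (hasCompactSupport_divergence (hS i))).integrableOn

/-! ### Algebra of the cross product and of curl -/

theorem inner_cross_rotate (a b c : E3) : inner ℝ a (cross b c) = inner ℝ b (cross c a) := by
  simp [cross, cross_apply, PiLp.inner_apply, Fin.sum_univ_three]
  ring

theorem cross_anticomm' (a b : E3) : cross a b = -cross b a := by
  ext i
  fin_cases i <;> simp [cross, cross_apply] <;> ring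

/-- The cross product as a continuous bilinear map. -/
noncomputable def crossL : E3 →L[ℝ] E3 →L[ℝ] E3 :=
  LinearMap.toContinuousLinearMap
    ((LinearMap.toContinuousLinearMap : (E3 →ₗ[ℝ] E3) ≃ₗ[ℝ] (E3 →L[ℝ] E3)).toLinearMap ∘ₗ
      LinearMap.mk₂ ℝ cross
        (fun a b c => by simp [cross])
        (fun r a b => by simp [cross])
        (fun a b c => by simp [cross])
        (fun r a b => by simp [cross]))

theorem crossL_apply (a b : E3) : crossL a b = cross a b := rfl

/-- The antisymmetric part of a linear map, as a vector. -/
noncomputable def curlOp : (E3 →L[ℝ] E3) →L[ℝ] E3 :=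
  LinearMap.toContinuousLinearMap
    { toFun := fun L =>
        !₂[L (EuclideanSpace.single 1 1) 2 - L (EuclideanSpace.single 2 1) 1,
           L (EuclideanSpace.single 2 1) 0 - L (EuclideanSpace.single 0 1) 2,
           L (EuclideanSpace.single 0 1) 1 - L (EuclideanSpace.single 1 1) 0]
      map_add' := fun L M => by ext i; fin_cases i <;> simp <;> ring
      map_smul' := fun a L => by ext i; fin_cases i <;> simp <;> ring }

theorem curlOp_apply (L : E3 →L[ℝ] E3) : curlOp L =
    !₂[L (EuclideanSpace.single 1 1) 2 - L (EuclideanSpace.single 2 1) 1,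
       L (EuclideanSpace.single 2 1) 0 - L (EuclideanSpace.single 0 1) 2,
       L (EuclideanSpace.single 0 1) 1 - L (EuclideanSpace.single 1 1) 0] := rfl

theorem curl_eq_curlOp (u : E3 → E3) (x : E3) : curl u x = curlOp (fderiv ℝ u x) := rfl

theorem dual_single_eq (p : E3 →L[ℝ] ℝ) (i : Fin 3) :
    p (EuclideanSpace.single i 1) = (InnerProductSpace.toDual ℝ E3).symm p i := by
  rw [← InnerProductSpace.toDual_symm_apply, real_inner_comm, EuclideanSpace.inner_single_left,
    map_one, one_mul]

/-- This rank-one case gives the gradient term in the product rule for curl and the curl of a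
mollified field. -/
theorem curlOp_smulRight (p : E3 →L[ℝ] ℝ) (v : E3) :
    curlOp (p.smulRight v) = cross ((InnerProductSpace.toDual ℝ E3).symm p) v := by
  rw [curlOp_apply]
  simp only [ContinuousLinearMap.smulRight_apply, dual_single_eq]
  ext i
  fin_cases i <;> simp [cross, cross_apply]

theorem curl_smul {χ : E3 → ℝ} {φ : E3 → E3} {x : E3} (hχ : DifferentiableAt ℝ χ x)
    (hφ : DifferentiableAt ℝ φ x) :
    curl (fun y => χ y • φ y) x = χ x • curl φ x + cross (gradient χ x) (φ x) := by
  rw [curl_eq_curlOp, fderiv_fun_smul hχ hφ, map_add, map_smul, curlOp_smulRight]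
  rfl

theorem curl_eq_zero_of_notMem {u : E3 → E3} {x : E3} (hx : x ∉ tsupport u) : curl u x = 0 := by
  rw [curl_eq_curlOp, fderiv_of_notMem_tsupport ℝ hx, map_zero]

theorem continuous_curl {u : E3 → E3} (hu : ContDiff ℝ 1 u) : Continuous (curl u) :=
  curlOp.continuous.comp (hu.continuous_fderiv one_ne_zero)

theorem hasCompactSupport_curl {u : E3 → E3} (hu : HasCompactSupport u) :
    HasCompactSupport (curl u) :=
  HasCompactSupport.intro hu fun _ hx => curl_eq_zero_of_notMem hx

theorem curl_add {u v : E3 → E3} (hu : Differentiable ℝ u) (hv : Differentiable ℝ v) (x : E3) :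
    curl (fun y => u y + v y) x = curl u x + curl v x := by
  rw [curl_eq_curlOp, fderiv_fun_add (hu x) (hv x), map_add]
  rfl

theorem curl_const_smul (c : ℝ) {u : E3 → E3} (hu : Differentiable ℝ u) (x : E3) :
    curl (fun y => c • u y) x = c • curl u x := by
  rw [curl_eq_curlOp, fderiv_fun_const_smul (hu x), map_smul]
  rfl

theorem IsC1Field.cross {h e : E3 → E3} (hh : IsC1Field h) (he : IsC1Field e) :
    IsC1Field fun x => cross (h x) (e x) := by
  refine ⟨?_, ?_⟩
  · exact (crossL.contDiff.comp hh.1).clm_apply he.1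
  · refine HasCompactSupport.intro hh.2 fun x hx => ?_
    rw [← crossL_apply, image_eq_zero_of_notMem_tsupport hx, map_zero]
    rfl

theorem divergence_cross {h e : E3 → E3} {x : E3} (hh : DifferentiableAt ℝ h x)
    (he : DifferentiableAt ℝ e x) :
    divergence (fun y => cross (h y) (e y)) x =
      inner ℝ (e x) (curl h x) - inner ℝ (h x) (curl e x) := by
  have h1 : HasFDerivAt (fun y => cross (h y) (e y)) _ x :=
    crossL.hasFDerivAt_of_bilinear hh.hasFDerivAt he.hasFDerivAt
  unfold divergence partialD
  rw [h1.fderiv, Fin.sum_univ_three]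
  simp [crossL_apply, cross, cross_apply, PiLp.inner_apply, Fin.sum_univ_three, curl, partialD]
  ring

/-! ### Weak curl on the whole space -/

/-- `z` is the distributional curl of `v` on the whole space. -/
def HasWeakCurlSpace (v z : E3 → E3) : Prop :=
  ∀ φ : E3 → E3, ContDiff ℝ ∞ φ → HasCompactSupport φ →
    ∫ x, inner ℝ (v x) (curl φ x) = ∫ x, inner ℝ (z x) (φ x)

theorem integrable_inner_of_memLp {α : Type*} [MeasurableSpace α] {μ : Measure α} {f g : α → E3}
    (hf : MemLp f 2 μ) (hg : MemLp g 2 μ) : Integrable (fun x => inner ℝ (f x) (g x)) μ := by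
  refine (L2.integrable_inner (𝕜 := ℝ) (hf.toLp f) (hg.toLp g)).congr ?_
  filter_upwards [hf.coeFn_toLp, hg.coeFn_toLp] with x h1 h2
  rw [h1, h2]

theorem memLp_of_continuous {f : E3 → E3} (hf : Continuous f) (hc : HasCompactSupport f) :
    MemLp f 2 volume :=
  hf.memLp_of_hasCompactSupport hc

theorem continuous_gradient {χ : E3 → ℝ} (hχ : ContDiff ℝ 1 χ) : Continuous (gradient χ) :=
  (InnerProductSpace.toDual ℝ E3).symm.continuous.comp (hχ.continuous_fderiv one_ne_zero)

theorem gradient_eq_zero_of_notMem {χ : E3 → ℝ} {x : E3} (hx : x ∉ tsupport χ) :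
    gradient χ x = 0 := by
  rw [gradient, fderiv_of_notMem_tsupport ℝ hx, map_zero]

theorem norm_cross_le (a b : E3) : ‖cross a b‖ ≤ ‖crossL‖ * ‖a‖ * ‖b‖ := crossL.le_opNorm₂ a b

theorem memLp_smul_of_bounded {χ : E3 → ℝ} (hχ : Continuous χ) {C : ℝ} (hC : ∀ x, ‖χ x‖ ≤ C)
    {v : E3 → E3} (hv : MemLp v 2 volume) : MemLp (fun x => χ x • v x) 2 volume :=
  hv.of_le_mul (c := C) (hχ.aestronglyMeasurable.smul hv.1)
    (.of_forall fun x => by rw [norm_smul]; gcongr; exact hC x)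

theorem memLp_cross_of_bounded {G : E3 → E3} (hG : Continuous G) {C : ℝ} (hC : ∀ x, ‖G x‖ ≤ C)
    {v : E3 → E3} (hv : MemLp v 2 volume) : MemLp (fun x => cross (G x) (v x)) 2 volume :=
  hv.of_le_mul (c := ‖crossL‖ * C)
    (crossL.aestronglyMeasurable_comp₂ hG.aestronglyMeasurable hv.1)
    (.of_forall fun x => (norm_cross_le _ _).trans (by gcongr; exact hC x))

/-- Testing with `χ φ` produces the extra term `v · (∇χ × φ)`, which the cyclic and antisymmetric
rules turn into `-(∇χ × v) · φ`. -/
theorem HasWeakCurlSpace.smul {v z : E3 → E3} (h : HasWeakCurlSpace v z) (hv : MemLp v 2 volume)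
    (hz : MemLp z 2 volume) {χ : E3 → ℝ} (hχ : ContDiff ℝ ∞ χ) :
    HasWeakCurlSpace (fun x => χ x • v x) (fun x => χ x • z x + cross (gradient χ x) (v x)) := by
  intro φ hφ hc
  have hχ1 : ContDiff ℝ 1 χ := hχ.of_le (by simp)
  have hφ1 : ContDiff ℝ 1 φ := hφ.of_le (by simp)
  have h1 := h (fun x => χ x • φ x) (hχ.smul hφ) (HasCompactSupport.smul_left (f := χ) hc)
  have hcurl : ∀ x, curl (fun y => χ y • φ y) x = χ x • curl φ x + cross (gradient χ x) (φ x) :=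
    fun x => curl_smul (hχ1.differentiable one_ne_zero x) (hφ1.differentiable one_ne_zero x)
  have hcross : ∀ x, inner ℝ (v x) (cross (gradient χ x) (φ x)) =
      - inner ℝ (cross (gradient χ x) (v x)) (φ x) := fun x => by
    rw [inner_cross_rotate, inner_cross_rotate, cross_anticomm', inner_neg_right, real_inner_comm]
  have hM1 : MemLp (fun x => χ x • curl φ x) 2 volume :=
    memLp_of_continuous (hχ1.continuous.smul (continuous_curl hφ1))
      (HasCompactSupport.smul_left (f := χ) (hasCompactSupport_curl hc))
  have hM2 : MemLp (fun x => cross (gradient χ x) (φ x)) 2 volume := by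
    refine memLp_of_continuous ((crossL.continuous.comp (continuous_gradient hχ1)).clm_apply
      hφ1.continuous) (HasCompactSupport.intro hc fun x hx => ?_)
    rw [image_eq_zero_of_notMem_tsupport hx, ← crossL_apply, map_zero]
  have hM3 : MemLp (fun x => χ x • φ x) 2 volume :=
    memLp_of_continuous (hχ1.continuous.smul hφ1.continuous)
      (HasCompactSupport.smul_left (f := χ) hc)
  simp_rw [hcurl, inner_add_right] at h1
  rw [integral_add (integrable_inner_of_memLp hv hM1) (integrable_inner_of_memLp hv hM2)] at h1
  have h2 : ∫ x, inner ℝ (χ x • v x) (curl φ x) = ∫ x, inner ℝ (v x) (χ x • curl φ x) := by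
    simp_rw [real_inner_smul_left, real_inner_smul_right]
  have h3 : ∀ x, inner ℝ (χ x • z x + cross (gradient χ x) (v x)) (φ x) =
      inner ℝ (z x) (χ x • φ x) - inner ℝ (v x) (cross (gradient χ x) (φ x)) := fun x => by
    rw [hcross, inner_add_left, real_inner_smul_left, real_inner_smul_right]; ring
  simp_rw [h3]
  rw [h2, integral_sub (integrable_inner_of_memLp hz hM3) (integrable_inner_of_memLp hv hM2)]
  linarith

/-- The convolution of a vector field with a scalar kernel. -/
noncomputable def mollify (ρ : E3 → ℝ) (v : E3 → E3) (x : E3) : E3 := ∫ y, ρ y • v (x - y)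

theorem contDiff_mollify {ρ : E3 → ℝ} (hρ : ContDiff ℝ ∞ ρ) (hc : HasCompactSupport ρ)
    {v : E3 → E3} (hv : LocallyIntegrable v) : ContDiff ℝ ∞ (mollify ρ v) :=
  HasCompactSupport.contDiff_convolution_left (n := ⊤) (ContinuousLinearMap.lsmul ℝ ℝ) hc hρ hv

/-- Pairing with a constant vector `a`, the derivative falls on the kernel, and the resulting
integral is the weak curl identity tested with `s ↦ ρ (x - s) • a`. -/
theorem HasWeakCurlSpace.curl_mollify {v z : E3 → E3} (h : HasWeakCurlSpace v z)
    (hv : LocallyIntegrable v) (hz : LocallyIntegrable z) {ρ : E3 → ℝ} (hρ : ContDiff ℝ ∞ ρ)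
    (hc : HasCompactSupport ρ) (x : E3) : curl (mollify ρ v) x = mollify ρ z x := by
  have hρ1 : ContDiff ℝ 1 ρ := hρ.of_le (by simp)
  have hd : HasFDerivAt (mollify ρ v) _ x :=
    hc.hasFDerivAt_convolution_left (μ := volume) (ContinuousLinearMap.lsmul ℝ ℝ) hρ1 hv x
  have hint := (hc.fderiv ℝ).convolutionExists_left (μ := volume)
    ((ContinuousLinearMap.lsmul ℝ ℝ : ℝ →L[ℝ] E3 →L[ℝ] E3).precompL E3)
    (hρ1.continuous_fderiv one_ne_zero) hv x
  refine ext_inner_left ℝ fun a => ?_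
  have hint2 : Integrable fun y => ρ y • z (x - y) :=
    hc.convolutionExists_left (μ := volume) (ContinuousLinearMap.lsmul ℝ ℝ) hρ1.continuous hz x
  have hR : inner ℝ a (mollify ρ z x) = ∫ t, inner ℝ (z t) (ρ (x - t) • a) := by
    have h1 := ((innerSL ℝ a).integral_comp_comm hint2).symm
    rw [mollify]
    change innerSL ℝ a _ = _
    rw [h1, ← integral_sub_left_eq_self _ volume x]
    refine integral_congr_ae (.of_forall fun t => ?_)
    simp [real_inner_smul_right, real_inner_comm]
  have hcrv : ∀ t, curl (fun s => ρ (x - s) • a) t = cross a (gradient ρ (x - t)) := by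
    intro t
    have h1 : HasFDerivAt (fun s => ρ (x - s)) (-fderiv ℝ ρ (x - t)) t := by
      have := (hρ1.differentiable one_ne_zero (x - t)).hasFDerivAt.comp t
        ((hasFDerivAt_const x t).sub (hasFDerivAt_id t))
      have h0 : fderiv ℝ ρ (x - t) ∘L (0 - ContinuousLinearMap.id ℝ E3) = -fderiv ℝ ρ (x - t) := by
        ext w; simp
      rw [h0] at this
      exact this
    rw [curl_eq_curlOp, (h1.smul_const a).fderiv, curlOp_smulRight, map_neg, cross_anticomm', ← crossL_apply,
      map_neg, neg_neg]
    rfl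
  rw [hR, ← h (fun s => ρ (x - s) • a) ?_ ?_]
  · simp_rw [hcrv]
    rw [curl_eq_curlOp, hd.fderiv]
    change (innerSL ℝ a ∘L curlOp) _ = _
    rw [convolution_def, ← ContinuousLinearMap.integral_comp_comm _ hint,
      ← integral_sub_left_eq_self _ volume x]
    refine integral_congr_ae (.of_forall fun t => ?_)
    have h4 : ((ContinuousLinearMap.lsmul ℝ ℝ : ℝ →L[ℝ] E3 →L[ℝ] E3).precompL E3)
        (fderiv ℝ ρ (x - t)) (v t) = (fderiv ℝ ρ (x - t)).smulRight (v t) := by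
      ext w; simp
    simp only [sub_sub_cancel, h4, ContinuousLinearMap.comp_apply, curlOp_smulRight]
    change inner ℝ a (cross (gradient ρ (x - t)) (v t)) = _
    rw [inner_cross_rotate, inner_cross_rotate]
  · exact (hρ.comp (contDiff_const.sub contDiff_id)).smul contDiff_const
  · have hcx : HasCompactSupport fun s => ρ (x - s) :=
      HasCompactSupport.comp_homeomorph hc (Homeomorph.subLeft x)
    exact HasCompactSupport.intro hcx fun s hs => by
      rw [image_eq_zero_of_notMem_tsupport hs, zero_smul]

/-! ### Translations into a Lipschitz domain -/

/-- Locally, the closure of a Lipschitz domain can be translated into the domain by arbitrarily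
short vectors from an open set. -/
theorem IsLipschitzDomain.exists_shift {Ω : Set E3} (hΩ : IsLipschitzDomain Ω) (x : E3) :
    ∃ r > 0, ∃ U : Set E3, IsOpen U ∧ 0 ∈ closure U ∧
      ∀ p ∈ closure Ω ∩ Metric.ball x r, ∀ y ∈ U, p + y ∈ Ω := by
  by_cases hx1 : x ∈ Ω
  · obtain ⟨r, hr, hb⟩ := Metric.isOpen_iff.1 hΩ.isOpen x hx1
    refine ⟨r / 2, by positivity, Metric.ball 0 (r / 2), Metric.isOpen_ball,
      subset_closure (Metric.mem_ball_self (by positivity)), fun p hp y hy => hb ?_⟩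
    have h1 := mem_ball_iff_norm.1 hp.2
    have h2 := mem_ball_zero_iff.1 hy
    rw [mem_ball_iff_norm]
    calc ‖p + y - x‖ = ‖(p - x) + y‖ := by congr 1; abel
      _ ≤ ‖p - x‖ + ‖y‖ := norm_add_le _ _
      _ < r := by linarith
  by_cases hx2 : x ∈ closure Ω
  · have hxf : x ∈ frontier Ω := by rw [hΩ.isOpen.frontier_eq]; exact ⟨hx2, hx1⟩
    obtain ⟨r, hr, e, K, g, hg, h⟩ := hΩ.exists_isSubgraphNear hxf
    set c := rotChart e
    -- The shifts point downward in a cone steeper than the Lipschitz constant, so they move points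
    -- on or below the graph strictly below it. Halving `r` keeps the shifted points in the chart
    -- ball.
    refine ⟨r / 2, by positivity,
      Metric.ball 0 (r / 2) ∩ {y | (c.symm y).2 < -(K * ‖(c.symm y).1‖)}, ?_, ?_, ?_⟩
    · refine Metric.isOpen_ball.inter (isOpen_lt ?_ ?_)
      · exact continuous_snd.comp c.symm.continuous
      · exact (continuous_const.mul (continuous_fst.comp c.symm.continuous).norm).neg
    · have hlim : Tendsto (fun s : ℝ => c (0, -s)) (𝓝[>] 0) (𝓝 0) := by
        have : Continuous fun s : ℝ => c (0, -s) := c.continuous.comp (by fun_prop)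
        have h0 : c (0, -(0 : ℝ)) = 0 := by rw [neg_zero]; exact map_zero c
        have h1 := this.tendsto 0
        rw [h0] at h1
        exact h1.mono_left nhdsWithin_le_nhds
      refine mem_closure_of_tendsto hlim ?_
      filter_upwards [hlim.eventually (Metric.ball_mem_nhds (0 : E3) (half_pos hr)),
        self_mem_nhdsWithin] with s hs1 hs2
      refine ⟨hs1, ?_⟩
      have : (0 : ℝ) < s := hs2
      simp [this]
    · rintro p ⟨hp1, hp2⟩ y ⟨hy1, hy2⟩
      obtain ⟨P, rfl⟩ := c.surjective p
      obtain ⟨Q, rfl⟩ := c.surjective y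
      simp only [mem_ofPred_eq, ContinuousLinearEquiv.symm_apply_apply] at hy2
      have hpb : c P ∈ Metric.ball x r := Metric.ball_subset_ball (by linarith) hp2
      have hle : P.2 ≤ g P.1 := by
        by_cases hP : c P ∈ Ω
        · exact ((h P hpb).1 hP).le
        · have : c P ∈ frontier Ω := by rw [hΩ.isOpen.frontier_eq]; exact ⟨hp1, hP⟩
          exact ((h.mem_frontier_iff hΩ.isOpen hg.continuous hpb).1 this).le
      rw [← map_add]
      refine (h (P + Q) ?_).2 ?_
      · have h1 := mem_ball_iff_norm.1 hp2
        have h2 := mem_ball_zero_iff.1 hy1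
        rw [mem_ball_iff_norm]
        calc ‖c (P + Q) - x‖ = ‖(c P - x) + c Q‖ := by rw [map_add]; congr 1; abel
          _ ≤ ‖c P - x‖ + ‖c Q‖ := norm_add_le _ _
          _ < r := by linarith
      · have h1 := hg.dist_le_mul (P.1 + Q.1) P.1
        rw [Real.dist_eq, dist_eq_norm, add_sub_cancel_left] at h1
        have h2 := (abs_le.1 h1).1
        simp only [Prod.snd_add, Prod.fst_add]
        linarith
  · obtain ⟨r, hr, hb⟩ := Metric.isOpen_iff.1 isClosed_closure.isOpen_compl x hx2
    exact ⟨r, hr, univ, isOpen_univ, by simp, fun p hp => absurd hp.1 (hb hp.2)⟩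

/-! ### Correlations of square integrable fields -/

/-- Translation acts continuously on `L²`; this is what later allows a shift to be sent to zero. -/
theorem continuous_integral_inner_translate {f h : E3 → E3} (hf : MemLp f 2 volume)
    (hh : MemLp h 2 volume) : Continuous fun y => ∫ x, inner ℝ (f x) (h (x - y)) := by
  have hmp : ∀ y : E3, MeasurePreserving (fun x : E3 => x - y) volume volume := fun y =>
    measurePreserving_sub_right volume y
  let G : E3 → C(E3, E3) := fun y => ⟨fun x => x - y, by fun_prop⟩
  have hG : Continuous G :=
    (ContinuousMap.curry ⟨fun p : E3 × E3 => p.2 - p.1, by fun_prop⟩).continuous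
  have h1 : Continuous fun y => Lp.compMeasurePreserving (G y) (hmp y) (hh.toLp h) :=
    Continuous.compMeasurePreservingLp continuous_const hG hmp (by simp)
  have h2 : Continuous fun y => inner ℝ (hf.toLp f)
      (Lp.compMeasurePreserving (G y) (hmp y) (hh.toLp h)) := continuous_const.inner h1
  convert h2 using 2 with y
  rw [L2.inner_def]
  refine integral_congr_ae ?_
  filter_upwards [hf.coeFn_toLp, Lp.coeFn_compMeasurePreserving (hh.toLp h) (hmp y),
    (hmp y).quasiMeasurePreserving.ae_eq_comp hh.coeFn_toLp] with x hx1 hx2 hx3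
  have hx4 : (Lp.compMeasurePreserving (G y) (hmp y) (hh.toLp h) : E3 → E3) x = h (x - y) :=
    hx2.trans hx3
  rw [hx1, hx4]

/-- Fubini applies because the integrand is dominated by `|ρ(y)| (‖f(x)‖² + ‖h(x - y)‖²)`, which is
integrable on the product. -/
theorem integral_inner_mollify {f h : E3 → E3} (hf : MemLp f 2 volume) (hh : MemLp h 2 volume)
    {ρ : E3 → ℝ} (hρ : Continuous ρ) (hc : HasCompactSupport ρ) :
    ∫ x, inner ℝ (f x) (mollify ρ h x) = ∫ y, ρ y * ∫ x, inner ℝ (f x) (h (x - y)) := by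
  have hhl : LocallyIntegrable h := hh.locallyIntegrable (by norm_num)
  have hρi : Integrable ρ := hρ.integrable_of_hasCompactSupport hc
  have hf2 : Integrable fun x => ‖f x‖ ^ 2 := hf.integrable_norm_pow (by norm_num)
  have hh2 : Integrable fun x => ‖h x‖ ^ 2 := hh.integrable_norm_pow (by norm_num)
  have hint : Integrable (fun p : E3 × E3 => ρ p.2 * inner ℝ (f p.1) (h (p.1 - p.2)))
      (volume.prod volume) := by
    have hb1 : Integrable (fun p : E3 × E3 => ‖f p.1‖ ^ 2 * ‖ρ p.2‖) (volume.prod volume) :=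
      hf2.mul_prod hρi.norm
    have hb2 : Integrable (fun p : E3 × E3 => ‖ρ p.2‖ * ‖h (p.1 - p.2)‖ ^ 2)
        (volume.prod volume) :=
      Integrable.convolution_integrand (ContinuousLinearMap.mul ℝ ℝ) hρi.norm hh2
    refine (hb1.add hb2).mono' ?_ (.of_forall fun p => ?_)
    · have h1 : AEStronglyMeasurable (fun p : E3 × E3 => f p.1) (volume.prod volume) :=
        hf.1.comp_fst
      have h2 : AEStronglyMeasurable (fun p : E3 × E3 => h (p.1 - p.2)) (volume.prod volume) :=
        hh.1.comp_quasiMeasurePreserving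
          (quasiMeasurePreserving_sub_of_right_invariant volume volume)
      exact (hρ.comp continuous_snd).aestronglyMeasurable.mul (h1.inner h2)
    · have h1 : ‖inner ℝ (f p.1) (h (p.1 - p.2))‖ ≤ ‖f p.1‖ * ‖h (p.1 - p.2)‖ :=
        norm_inner_le_norm _ _
      rw [norm_mul]
      have h2 : ‖ρ p.2‖ * ‖inner ℝ (f p.1) (h (p.1 - p.2))‖ ≤
          ‖ρ p.2‖ * (‖f p.1‖ * ‖h (p.1 - p.2)‖) := by gcongr
      refine h2.trans ?_
      simp only [Pi.add_apply]
      nlinarith [mul_nonneg (norm_nonneg (ρ p.2)) (sq_nonneg (‖f p.1‖ - ‖h (p.1 - p.2)‖)),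
        mul_nonneg (norm_nonneg (ρ p.2)) (sq_nonneg ‖f p.1‖),
        mul_nonneg (norm_nonneg (ρ p.2)) (sq_nonneg ‖h (p.1 - p.2)‖)]
  calc ∫ x, inner ℝ (f x) (mollify ρ h x)
      = ∫ x, ∫ y, ρ y * inner ℝ (f x) (h (x - y)) := by
        refine integral_congr_ae (.of_forall fun x => ?_)
        have h1 : Integrable fun y => ρ y • h (x - y) :=
          hc.convolutionExists_left (μ := volume) (ContinuousLinearMap.lsmul ℝ ℝ) hρ hhl x
        have h2 := ((innerSL ℝ (f x)).integral_comp_comm h1).symm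
        change innerSL ℝ (f x) _ = _
        rw [mollify, h2]
        refine integral_congr_ae (.of_forall fun y => ?_)
        simp
    _ = ∫ y, ∫ x, ρ y * inner ℝ (f x) (h (x - y)) := integral_integral_swap hint
    _ = _ := by simp_rw [integral_const_mul]

theorem memLp_indicator_coe {Ω : Set E3} (hΩ : IsOpen Ω) (u : L2Field Ω) :
    MemLp (Ω.indicator u) 2 volume :=
  (memLp_indicator_iff_restrict hΩ.measurableSet).2 (Lp.memLp u)

theorem integral_inner_indicator {Ω : Set E3} (hΩ : IsOpen Ω) (u G : E3 → E3) :
    ∫ x, inner ℝ (Ω.indicator u x) (G x) = ∫ x in Ω, inner ℝ (u x) (G x) := by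
  rw [← integral_indicator hΩ.measurableSet]
  congr 1
  funext x
  by_cases hx : x ∈ Ω <;> simp [hx]

open scoped Pointwise in
/-- Integration by parts against a field that can be translated into the domain. -/
theorem HasWeakCurl.integral_inner_eq_of_shift {Ω : Set E3} (hΩ : IsOpen Ω) {u w : L2Field Ω}
    (huw : HasWeakCurl Ω u w) {v z : E3 → E3} (hv : MemLp v 2 volume) (hz : MemLp z 2 volume)
    (hvz : HasWeakCurlSpace v z) {S : Set E3} (hS : IsCompact S) (hv0 : ∀ x ∉ S, v x = 0)
    {U : Set E3} (hU : IsOpen U) (h0 : 0 ∈ closure U) (hsh : ∀ p ∈ S, ∀ y ∈ U, p + y ∈ Ω) :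
    ∫ x in Ω, inner ℝ (u x) (z x) = ∫ x in Ω, inner ℝ (w x) (v x) := by
  have hvl : LocallyIntegrable v := hv.locallyIntegrable (by norm_num)
  have hzl : LocallyIntegrable z := hz.locallyIntegrable (by norm_num)
  have hu2 := memLp_indicator_coe hΩ u
  have hw2 := memLp_indicator_coe hΩ w
  -- `c y` is the defect of the identity when `v` and `z` are translated by `y`; the goal is `c 0 =
  -- 0`.
  set c : E3 → ℝ := fun y => (∫ x, inner ℝ (Ω.indicator u x) (z (x - y))) -
    ∫ x, inner ℝ (Ω.indicator w x) (v (x - y)) with hc_def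
  have hc1 := continuous_integral_inner_translate hu2 hz
  have hc2 := continuous_integral_inner_translate hw2 hv
  have hcc : Continuous c := hc1.sub hc2
  have hae : ∀ᵐ y, y ∈ U → c y = 0 := by
    refine hU.ae_eq_zero_of_integral_contDiff_smul_eq_zero
      (hcc.locallyIntegrable.locallyIntegrableOn U) fun ρ hρ hρc hρU => ?_
    -- For `ρ` supported in `U`, the mollified `v` is a smooth field with compact support in `Ω`,
    -- hence an admissible test field. Its test identity says that `c` integrates to zero against
    -- `ρ`.
    have hsub : tsupport ρ + S ⊆ Ω := by
      rintro _ ⟨y, hy, p, hp, rfl⟩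
      simpa [add_comm] using hsh p hp y (hρU hy)
    have hT : IsCompact (tsupport ρ + S) := IsCompact.add hρc hS
    have hzero : ∀ x ∉ tsupport ρ + S, mollify ρ v x = 0 := by
      intro x hx
      rw [mollify, ← integral_zero E3 E3]
      refine integral_congr_ae (.of_forall fun y => ?_)
      by_cases hy : y ∈ tsupport ρ
      · have : x - y ∉ S := fun h => hx ⟨y, hy, x - y, h, by simp⟩
        simp [hv0 _ this]
      · simp [image_eq_zero_of_notMem_tsupport hy]
    have hts : tsupport (mollify ρ v) ⊆ tsupport ρ + S :=
      closure_minimal (fun x hx => by_contra fun h => hx (hzero x h)) hT.isClosed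
    have htest := huw (mollify ρ v) (contDiff_mollify hρ hρc hvl)
      (HasCompactSupport.intro hT hzero) (hts.trans hsub)
    simp_rw [hvz.curl_mollify hvl hzl hρ hρc] at htest
    rw [← integral_inner_indicator hΩ, ← integral_inner_indicator hΩ,
      integral_inner_mollify hu2 hz hρ.continuous hρc,
      integral_inner_mollify hw2 hv hρ.continuous hρc] at htest
    have hi : ∀ {k : E3 → ℝ}, Continuous k → Integrable fun y => ρ y * k y := fun hk =>
      (hρ.continuous.mul hk).integrable_of_hasCompactSupport hρc.mul_right
    simp only [smul_eq_mul, hc_def, mul_sub]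
    rw [integral_sub (hi hc1) (hi hc2), htest, sub_self]
  have hUz : ∀ y ∈ U, c y = 0 := by
    by_contra! hne
    obtain ⟨y, hyU, hy⟩ := hne
    have hopen : IsOpen (U ∩ {y | c y ≠ 0}) := hU.inter (isOpen_ne_fun hcc continuous_const)
    have hnull : volume (U ∩ {y | c y ≠ 0}) = 0 := by
      refine measure_mono_null ?_ hae
      rintro y ⟨h1, h2⟩ h3
      exact h2 (h3 h1)
    have := (hopen.measure_eq_zero_iff volume).1 hnull
    exact this.subset ⟨hyU, hy⟩
  -- The zero shift lies only in the closure of `U`, so continuity of `c` is essential.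
  have hcz : c 0 = 0 :=
    closure_minimal (t := {y | c y = 0}) hUz (isClosed_eq hcc continuous_const) h0
  simp only [hc_def, sub_zero] at hcz
  rw [← integral_inner_indicator hΩ, ← integral_inner_indicator hΩ]
  linarith

/-! ### Integration by parts up to the boundary -/

theorem exists_bound_of_hasCompactSupport {χ : E3 → ℝ} (hχ : ContDiff ℝ ∞ χ)
    (hc : HasCompactSupport χ) : ∃ C, (∀ x, ‖χ x‖ ≤ C) ∧ ∀ x, ‖gradient χ x‖ ≤ C := by
  obtain ⟨C₁, h₁⟩ := hχ.continuous.bounded_above_of_compact_support hc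
  have hg : HasCompactSupport (gradient χ) :=
    HasCompactSupport.intro hc fun _ hx => gradient_eq_zero_of_notMem hx
  obtain ⟨C₂, h₂⟩ :=
    (continuous_gradient (hχ.of_le (by simp))).bounded_above_of_compact_support hg
  exact ⟨max C₁ C₂, fun x => (h₁ x).trans (le_max_left _ _), fun x => (h₂ x).trans (le_max_right _ _)⟩

/-- A partition of unity on the support of `χ` splits `χ v` into pieces, each carried by a compact
part of `closure Ω` inside a ball that has its own set of inward shifts. -/
theorem HasWeakCurl.integral_inner_cutoff {Ω : Set E3} (hΩ : IsLipschitzDomain Ω)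
    {u w : L2Field Ω} (huw : HasWeakCurl Ω u w) {v z : E3 → E3} (hv : MemLp v 2 volume)
    (hz : MemLp z 2 volume) (hvz : HasWeakCurlSpace v z) (hv0 : ∀ x ∉ Ω, v x = 0)
    {χ : E3 → ℝ} (hχ : ContDiff ℝ ∞ χ) (hc : HasCompactSupport χ) :
    ∫ x in Ω, inner ℝ (u x) (χ x • z x + cross (gradient χ x) (v x)) =
      ∫ x in Ω, inner ℝ (w x) (χ x • v x) := by
  choose r hr U hU h0 hsh using hΩ.exists_shift
  obtain ⟨t, ψ, hψ, hψs, hψ1⟩ := exists_finite_smooth_partition (K := tsupport χ) hc r hr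
  have hC : ∀ i, ContDiff ℝ ∞ fun x => ψ i x * χ x := fun i => (hψ i).mul hχ
  have hS : ∀ i, HasCompactSupport fun x => ψ i x * χ x := fun i =>
    HasCompactSupport.mul_left (f := ψ i) hc
  have hsum : ∀ x, χ x = ∑ i, ψ i x * χ x := by
    intro x
    by_cases hx : x ∈ tsupport χ
    · rw [← Finset.sum_mul, hψ1 x hx, one_mul]
    · simp [image_eq_zero_of_notMem_tsupport hx]
  have hgrad : ∀ x, gradient χ x = ∑ i, gradient (fun x => ψ i x * χ x) x := by
    intro x
    unfold gradient
    rw [← map_sum, ← fderiv_fun_sum fun i _ => (hC i).differentiable (by simp) x]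
    congr 3
    funext x
    exact hsum x
  have hV : ∀ i, MemLp (fun x => (ψ i x * χ x) • v x) 2 volume := fun i => by
    obtain ⟨C, hC1, -⟩ := exists_bound_of_hasCompactSupport (hC i) (hS i)
    exact memLp_smul_of_bounded (hC i).continuous hC1 hv
  have hZ : ∀ i, MemLp (fun x => (ψ i x * χ x) • z x +
      cross (gradient (fun x => ψ i x * χ x) x) (v x)) 2 volume := fun i => by
    obtain ⟨C, hC1, hC2⟩ := exists_bound_of_hasCompactSupport (hC i) (hS i)
    exact (memLp_smul_of_bounded (hC i).continuous hC1 hz).add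
      (memLp_cross_of_bounded (continuous_gradient ((hC i).of_le (by simp))) hC2 hv)
  have hi : ∀ i, ∫ x in Ω, inner ℝ (u x) ((ψ i x * χ x) • z x +
      cross (gradient (fun x => ψ i x * χ x) x) (v x)) =
      ∫ x in Ω, inner ℝ (w x) ((ψ i x * χ x) • v x) := by
    intro i
    have hts : tsupport (fun x => ψ i x * χ x) ⊆ Metric.ball (i : E3) (r i) :=
      (closure_mono (Function.support_mul_subset_left (ψ i) χ)).trans (hψs i)
    refine huw.integral_inner_eq_of_shift hΩ.isOpen (hV i) (hZ i) (hvz.smul hv hz (hC i))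
      (S := closure Ω ∩ tsupport fun x => ψ i x * χ x)
      (IsCompact.inter_left (hS i) isClosed_closure) (fun x hx => ?_) (hU i) (h0 i)
      (fun p hp => hsh i p ⟨hp.1, hts hp.2⟩)
    by_cases hxΩ : x ∈ Ω
    · have : x ∉ tsupport fun x => ψ i x * χ x := fun h => hx ⟨subset_closure hxΩ, h⟩
      rw [show ψ i x * χ x = 0 from
        image_eq_zero_of_notMem_tsupport (f := fun x => ψ i x * χ x) this, zero_smul]
    · rw [hv0 x hxΩ, smul_zero]
  have hu := Lp.memLp u
  have hw := Lp.memLp w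
  have e1 : ∀ x, inner ℝ (u x) (χ x • z x + cross (gradient χ x) (v x)) =
      ∑ i, inner ℝ (u x) ((ψ i x * χ x) • z x +
        cross (gradient (fun x => ψ i x * χ x) x) (v x)) := by
    intro x
    rw [← inner_sum, Finset.sum_add_distrib, ← Finset.sum_smul, ← hsum, hgrad, ← crossL_apply,
      map_sum, sum_apply]
    rfl
  have e2 : ∀ x, inner ℝ (w x) (χ x • v x) = ∑ i, inner ℝ (w x) ((ψ i x * χ x) • v x) := by
    intro x
    rw [← inner_sum, ← Finset.sum_smul, ← hsum]
  simp_rw [e1, e2]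
  rw [integral_finsetSum _ fun i _ => integrable_inner_of_memLp hu ((hZ i).restrict Ω),
    integral_finsetSum _ fun i _ => integrable_inner_of_memLp hw ((hV i).restrict Ω)]
  exact Finset.sum_congr rfl fun i _ => hi i

/-- Dilations of one bump function: the gradient picks up the factor `(n + 1)⁻¹`. -/
theorem exists_cutoff_sequence : ∃ (χ : ℕ → E3 → ℝ) (C : ℝ), (∀ n, ContDiff ℝ ∞ (χ n)) ∧
    (∀ n, HasCompactSupport (χ n)) ∧ (∀ n x, ‖χ n x‖ ≤ 1) ∧
    (∀ n x, ‖gradient (χ n) x‖ ≤ C) ∧ (∀ x, Tendsto (fun n => χ n x) atTop (𝓝 1)) ∧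
    ∀ x, Tendsto (fun n => gradient (χ n) x) atTop (𝓝 0) := by
  let f : ContDiffBump (0 : E3) := ⟨1, 2, by norm_num, by norm_num⟩
  have hf : ContDiff ℝ ∞ f := f.contDiff
  obtain ⟨C, -, hC⟩ := exists_bound_of_hasCompactSupport hf f.hasCompactSupport
  have hC0 : 0 ≤ C := (norm_nonneg _).trans (hC 0)
  let a : ℕ → ℝ := fun n => ((n : ℝ) + 1)⁻¹
  have ha0 : ∀ n, 0 < a n := fun n => by positivity
  have ha1 : ∀ n, a n ≤ 1 := fun n => inv_le_one_of_one_le₀ (by simp)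
  have ha : Tendsto a atTop (𝓝 0) := by
    simpa [a, one_div] using tendsto_one_div_add_atTop_nhds_zero_nat (𝕜 := ℝ)
  have hgrad : ∀ n x, gradient (fun x => f (a n • x)) x = a n • gradient f (a n • x) := by
    intro n x
    have h1 : HasFDerivAt (fun x : E3 => f (a n • x))
        (fderiv ℝ f (a n • x) ∘L (a n • ContinuousLinearMap.id ℝ E3)) x :=
      (hf.differentiable (by simp) (a n • x)).hasFDerivAt.comp x ((hasFDerivAt_id x).const_smul (a n))
    rw [gradient, h1.fderiv, ContinuousLinearMap.comp_smul, ContinuousLinearMap.comp_id, gradient,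
      map_smulₛₗ]
    rfl
  refine ⟨fun n x => f (a n • x), C, fun n => hf.comp (contDiff_const_smul (a n)), fun n => ?_,
    fun n x => ?_, fun n x => ?_, fun x => ?_, fun x => ?_⟩
  · exact f.hasCompactSupport.comp_homeomorph (Homeomorph.smulOfNeZero (a n) (ha0 n).ne')
  · rw [Real.norm_of_nonneg f.nonneg]
    exact f.le_one
  · rw [hgrad, norm_smul, Real.norm_of_nonneg (ha0 n).le]
    calc a n * ‖gradient f (a n • x)‖ ≤ 1 * C := by gcongr; exacts [ha1 n, hC _]
      _ = C := one_mul C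
  · have h1 : Tendsto (fun n => a n • x) atTop (𝓝 0) := by simpa using ha.smul_const x
    have h2 := (hf.continuous.tendsto 0).comp h1
    have h3 : f (0 : E3) = 1 := f.one_of_mem_closedBall (Metric.mem_closedBall_self (by simp [f]))
    rw [h3] at h2
    exact h2
  · rw [tendsto_zero_iff_norm_tendsto_zero]
    refine squeeze_zero (fun n => norm_nonneg _) (fun n => ?_) (by simpa using ha.mul_const C)
    rw [hgrad, norm_smul, Real.norm_of_nonneg (ha0 n).le]
    have := ha0 n
    gcongr
    exact hC _

/-- A field that vanishes off `Ω` and has a square integrable curl on all of space behaves as if its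
tangential trace were zero, so no boundary term appears. Dominated convergence removes the cutoff,
which is needed because `Ω` may be unbounded. -/
theorem HasWeakCurl.integral_inner_eq_of_space {Ω : Set E3} (hΩ : IsLipschitzDomain Ω)
    {u w : L2Field Ω} (huw : HasWeakCurl Ω u w) {v z : E3 → E3} (hv : MemLp v 2 volume)
    (hz : MemLp z 2 volume) (hvz : HasWeakCurlSpace v z) (hv0 : ∀ x ∉ Ω, v x = 0) :
    ∫ x in Ω, inner ℝ (u x) (z x) = ∫ x in Ω, inner ℝ (w x) (v x) := by
  obtain ⟨χ, C, hχ, hχc, hχ1, hχC, hlim, hlimg⟩ := exists_cutoff_sequence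
  have hu := Lp.memLp u
  have hw := Lp.memLp w
  have hvr := hv.restrict Ω
  have hzr := hz.restrict Ω
  have hprod : ∀ {f g : E3 → E3}, MemLp f 2 (volume.restrict Ω) → MemLp g 2 (volume.restrict Ω) →
      Integrable (fun x => ‖f x‖ * ‖g x‖) (volume.restrict Ω) := fun hf hg =>
    MemLp.integrable_mul hf.norm hg.norm
  have hL : Tendsto (fun n => ∫ x in Ω, inner ℝ (u x) (χ n x • z x + cross (gradient (χ n) x) (v x)))
      atTop (𝓝 (∫ x in Ω, inner ℝ (u x) (z x))) := by
    refine tendsto_integral_of_dominated_convergence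
      (fun x => ‖u x‖ * ‖z x‖ + ‖crossL‖ * C * (‖u x‖ * ‖v x‖)) (fun n => ?_)
      ((hprod hu hzr).add ((hprod hu hvr).const_mul _)) (fun n => .of_forall fun x => ?_)
      (.of_forall fun x => ?_)
    · exact (integrable_inner_of_memLp hu
        ((memLp_smul_of_bounded (hχ n).continuous (hχ1 n) hz).add
          (memLp_cross_of_bounded (continuous_gradient ((hχ n).of_le (by simp)))
            (hχC n) hv) |>.restrict Ω)).aestronglyMeasurable
    · refine (norm_inner_le_norm _ _).trans ?_
      have h1 : ‖χ n x • z x‖ ≤ 1 * ‖z x‖ := by rw [norm_smul]; gcongr; exact hχ1 n x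
      have h2 : ‖cross (gradient (χ n) x) (v x)‖ ≤ ‖crossL‖ * C * ‖v x‖ :=
        (norm_cross_le _ _).trans (by gcongr; exact hχC n x)
      have h3 := (norm_add_le (χ n x • z x) (cross (gradient (χ n) x) (v x))).trans
        (add_le_add h1 h2)
      calc _ ≤ ‖u x‖ * (1 * ‖z x‖ + ‖crossL‖ * C * ‖v x‖) := by gcongr
        _ = _ := by ring
    · have h1 : Tendsto (fun n => χ n x • z x + crossL (gradient (χ n) x) (v x)) atTop
          (𝓝 ((1 : ℝ) • z x + crossL 0 (v x))) := by
        refine ((hlim x).smul_const (z x)).add ?_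
        exact ((crossL.flip (v x)).continuous.tendsto 0).comp (hlimg x)
      rw [one_smul, map_zero, zero_apply, add_zero] at h1
      exact tendsto_const_nhds.inner h1
  have hR : Tendsto (fun n => ∫ x in Ω, inner ℝ (w x) (χ n x • v x))
      atTop (𝓝 (∫ x in Ω, inner ℝ (w x) (v x))) := by
    refine tendsto_integral_of_dominated_convergence
      (fun x => ‖w x‖ * ‖v x‖) (fun n => ?_) (hprod hw hvr) (fun n => .of_forall fun x => ?_)
      (.of_forall fun x => ?_)
    · exact (integrable_inner_of_memLp hw ((memLp_smul_of_bounded (hχ n).continuous (hχ1 n)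
        hv).restrict Ω)).aestronglyMeasurable
    · refine (norm_inner_le_norm _ _).trans ?_
      have h1 : ‖χ n x • v x‖ ≤ 1 * ‖v x‖ := by rw [norm_smul]; gcongr; exact hχ1 n x
      rw [one_mul] at h1
      gcongr
    · have h1 := (hlim x).smul_const (v x)
      rw [one_smul] at h1
      exact tendsto_const_nhds.inner h1
  simp_rw [fun n => huw.integral_inner_cutoff hΩ hv hz hvz hv0 (hχ n) (hχc n)] at hL
  exact tendsto_nhds_unique hL hR

/-! ### Density of smooth fields in `H^curl` -/

theorem IsC1Field.add {f g : E3 → E3} (hf : IsC1Field f) (hg : IsC1Field g) :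
    IsC1Field fun x => f x + g x := ⟨hf.1.add hg.1, HasCompactSupport.add hf.2 hg.2⟩

theorem IsC1Field.const_smul (c : ℝ) {f : E3 → E3} (hf : IsC1Field f) :
    IsC1Field fun x => c • f x :=
  ⟨(contDiff_const (c := c)).smul hf.1, HasCompactSupport.smul_left (f := fun _ => c) hf.2⟩

theorem IsC1Field.zero : IsC1Field fun _ => 0 := ⟨contDiff_const, HasCompactSupport.zero⟩

theorem IsC1Field.differentiable {f : E3 → E3} (hf : IsC1Field f) : Differentiable ℝ f :=
  hf.1.differentiable one_ne_zero

theorem IsC1Field.memLp {f : E3 → E3} (hf : IsC1Field f) (Ω : Set E3) :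
    MemLp f 2 (volume.restrict Ω) := (memLp_of_continuous hf.1.continuous hf.2).restrict Ω

theorem IsC1Field.memLp_curl {f : E3 → E3} (hf : IsC1Field f) (Ω : Set E3) :
    MemLp (curl f) 2 (volume.restrict Ω) :=
  (memLp_of_continuous (continuous_curl hf.1) (hasCompactSupport_curl hf.2)).restrict Ω

/-- An element of `L² × L²` orthogonal to the graph of curl over `C¹` fields is orthogonal to the
graph of the weak curl. -/
theorem HasWeakCurl.inner_add_inner_eq_zero {Ω : Set E3} (hΩ : IsLipschitzDomain Ω)
    {u w : L2Field Ω} (huw : HasWeakCurl Ω u w) {a b : L2Field Ω}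
    (hab : ∀ φ, IsC1Field φ →
      (∫ x in Ω, inner ℝ (a x) (φ x)) + ∫ x in Ω, inner ℝ (b x) (curl φ x) = 0) :
    (∫ x in Ω, inner ℝ (a x) (u x)) + ∫ x in Ω, inner ℝ (b x) (w x) = 0 := by
  have ha := memLp_indicator_coe hΩ.isOpen a
  have hb := memLp_indicator_coe hΩ.isOpen b
  -- The fields in `hab` need not vanish near the boundary, so orthogonality gives a curl identity
  -- on all of `ℝ³` for the zero extension of `b`, not only inside `Ω`.
  have hweak : HasWeakCurlSpace (Ω.indicator b) (-Ω.indicator a) := by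
    intro φ hφ hc
    have h1 := hab φ ⟨hφ.of_le (by simp), hc⟩
    rw [← integral_inner_indicator hΩ.isOpen, ← integral_inner_indicator hΩ.isOpen] at h1
    simp only [Pi.neg_apply, inner_neg_left, integral_neg]
    linarith
  have h := huw.integral_inner_eq_of_space hΩ hb ha.neg hweak
    fun x hx => indicator_of_notMem hx _
  simp_rw [Pi.neg_apply, inner_neg_right, integral_neg, real_inner_comm] at h
  have hs : ∀ f g : E3 → E3, ∫ x in Ω, inner ℝ (Ω.indicator f x) (g x) =
      ∫ x in Ω, inner ℝ (f x) (g x) := fun f g =>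
    setIntegral_congr_fun hΩ.isOpen.measurableSet fun x hx => by
      simp only [indicator_of_mem hx]
  rw [hs, hs] at h
  linarith

/-- The graph of curl over compactly supported `C¹` fields, in `L²(Ω) × L²(Ω)`. -/
noncomputable def curlGraph (Ω : Set E3) : Submodule ℝ (WithLp 2 (L2Field Ω × L2Field Ω)) where
  carrier := {p | ∃ f, IsC1Field f ∧ p.fst =ᵐ[volume.restrict Ω] f ∧
    p.snd =ᵐ[volume.restrict Ω] curl f}
  add_mem' := by
    rintro p q ⟨f, hf, hf1, hf2⟩ ⟨g, hg, hg1, hg2⟩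
    refine ⟨_, hf.add hg, ?_, ?_⟩
    · filter_upwards [Lp.coeFn_add p.fst q.fst, hf1, hg1] with x h1 h2 h3
      rw [WithLp.add_fst, h1, Pi.add_apply, h2, h3]
    · filter_upwards [Lp.coeFn_add p.snd q.snd, hf2, hg2] with x h1 h2 h3
      rw [WithLp.add_snd, h1, Pi.add_apply, h2, h3, curl_add hf.differentiable hg.differentiable]
  zero_mem' := by
    refine ⟨_, IsC1Field.zero, ?_, ?_⟩
    · exact Lp.coeFn_zero _ _ _
    · filter_upwards [Lp.coeFn_zero E3 2 (volume.restrict Ω)] with x hx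
      rw [WithLp.zero_snd, hx, curl_eq_curlOp, fderiv_const_apply, map_zero]
      rfl
  smul_mem' := by
    rintro c p ⟨f, hf, hf1, hf2⟩
    refine ⟨_, hf.const_smul c, ?_, ?_⟩
    · filter_upwards [Lp.coeFn_smul c p.fst, hf1] with x h1 h2
      rw [WithLp.smul_fst, h1, Pi.smul_apply, h2]
    · filter_upwards [Lp.coeFn_smul c p.snd, hf2] with x h1 h2
      rw [WithLp.smul_snd, h1, Pi.smul_apply, h2, curl_const_smul c hf.differentiable]

/-- Compactly supported `C¹` fields are dense in `H^curl(Ω)`. -/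
theorem HasWeakCurl.exists_approximation {Ω : Set E3} (hΩ : IsLipschitzDomain Ω)
    {u w : L2Field Ω} (huw : HasWeakCurl Ω u w) : ∃ f, ApproximatesInHCurl Ω f u := by
  have hmem : WithLp.toLp 2 (u, w) ∈ (curlGraph Ω).topologicalClosure := by
    -- In a Hilbert space the closure of a subspace is its double orthogonal complement, so density
    -- becomes a statement about orthogonal pairs.
    rw [← Submodule.orthogonal_orthogonal_eq_closure, Submodule.mem_orthogonal]
    intro q hq
    rw [Submodule.mem_orthogonal'] at hq
    rw [WithLp.prod_inner_apply, L2.inner_def, L2.inner_def]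
    refine huw.inner_add_inner_eq_zero hΩ fun φ hφ => ?_
    have h1 := hq (WithLp.toLp 2 ((hφ.memLp Ω).toLp φ, (hφ.memLp_curl Ω).toLp (curl φ)))
      ⟨φ, hφ, (hφ.memLp Ω).coeFn_toLp, (hφ.memLp_curl Ω).coeFn_toLp⟩
    rw [WithLp.prod_inner_apply, L2.inner_def, L2.inner_def] at h1
    rw [← h1]
    congr 1
    · refine integral_congr_ae ?_
      filter_upwards [(hφ.memLp Ω).coeFn_toLp] with x hx
      rw [← hx]
    · refine integral_congr_ae ?_
      filter_upwards [(hφ.memLp_curl Ω).coeFn_toLp] with x hx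
      rw [← hx]
  obtain ⟨p, hp, hlim⟩ := mem_closure_iff_seq_limit.1 hmem
  choose f hf hf1 hf2 using hp
  refine ⟨f, hf, w, huw, ?_, ?_⟩
  · have h1 : Tendsto (fun k => (p k).fst) atTop (𝓝 u) :=
      ((WithLp.prod_continuous_ofLp 2 _ _).fst.tendsto _).comp hlim
    rw [Lp.tendsto_Lp_iff_tendsto_eLpNorm'] at h1
    refine h1.congr fun k => eLpNorm_congr_ae ?_
    filter_upwards [hf1 k] with x hx
    rw [Pi.sub_apply, hx]
  · have h1 : Tendsto (fun k => (p k).snd) atTop (𝓝 w) :=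
      ((WithLp.prod_continuous_ofLp 2 _ _).snd.tendsto _).comp hlim
    rw [Lp.tendsto_Lp_iff_tendsto_eLpNorm'] at h1
    refine h1.congr fun k => eLpNorm_congr_ae ?_
    filter_upwards [hf2 k] with x hx
    rw [Pi.sub_apply, hx]

/-! ### The boundary flux -/

/-- Test fields `g • a` reduce this to the fundamental lemma of the calculus of variations. It
identifies the curls chosen separately in Maxwell's equations and in the approximations. -/
theorem HasWeakCurl.unique {Ω : Set E3} (hΩ : IsOpen Ω) {u w w' : L2Field Ω}
    (h : HasWeakCurl Ω u w) (h' : HasWeakCurl Ω u w') : w = w' := by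
  have hf : MemLp (Ω.indicator (w - w' : L2Field Ω)) 2 volume := memLp_indicator_coe hΩ _
  have hfl : LocallyIntegrable (Ω.indicator (w - w' : L2Field Ω)) volume :=
    hf.locallyIntegrable (by norm_num)
  have hae : ∀ᵐ x, x ∈ Ω → Ω.indicator (w - w' : L2Field Ω) x = 0 := by
    refine hΩ.ae_eq_zero_of_integral_contDiff_smul_eq_zero (hfl.locallyIntegrableOn Ω)
      fun g hg hgc hgΩ => ext_inner_left ℝ fun a => ?_
    have hgi : Integrable fun x => g x • Ω.indicator (w - w' : L2Field Ω) x :=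
      hfl.integrable_smul_left_of_hasCompactSupport hg.continuous hgc
    have hφ : IsC1Field fun x => g x • a :=
      ⟨(hg.of_le (by simp)).smul contDiff_const, HasCompactSupport.intro hgc fun x hx => by
        rw [image_eq_zero_of_notMem_tsupport hx, zero_smul]⟩
    have h1 := h _ (hg.smul contDiff_const) hφ.2
      ((tsupport_smul_subset_left g fun _ => a).trans hgΩ)
    have h2 := h' _ (hg.smul contDiff_const) hφ.2
      ((tsupport_smul_subset_left g fun _ => a).trans hgΩ)
    have h3 : inner ℝ a (∫ x, g x • Ω.indicator (w - w' : L2Field Ω) x) =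
        ∫ x, inner ℝ (Ω.indicator (w - w' : L2Field Ω) x) (g x • a) := by
      have h4 := ((innerSL ℝ a).integral_comp_comm hgi).symm
      change innerSL ℝ a _ = _
      rw [h4]
      refine integral_congr_ae (.of_forall fun x => ?_)
      change inner ℝ a (g x • Ω.indicator (w - w' : L2Field Ω) x) =
        inner ℝ (Ω.indicator (w - w' : L2Field Ω) x) (g x • a)
      rw [real_inner_smul_right, real_inner_smul_right, real_inner_comm]
    rw [h3, integral_inner_indicator hΩ, inner_zero_right]
    have h5 : ∫ x in Ω, inner ℝ ((w - w' : L2Field Ω) x) (g x • a) =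
        ∫ x in Ω, (inner ℝ (w x) (g x • a) - inner ℝ (w' x) (g x • a)) := by
      refine integral_congr_ae ?_
      filter_upwards [Lp.coeFn_sub w w'] with x hx
      rw [hx, Pi.sub_apply, inner_sub_left]
    rw [h5, integral_sub (integrable_inner_of_memLp (Lp.memLp w) (hφ.memLp Ω))
      (integrable_inner_of_memLp (Lp.memLp w') (hφ.memLp Ω))]
    exact sub_eq_zero.2 (h1.symm.trans h2)
  rw [← sub_eq_zero]
  refine Lp.eq_zero_iff_ae_eq_zero.2 ?_
  rw [EventuallyEq, ae_restrict_iff' hΩ.measurableSet]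
  filter_upwards [hae] with x hx hxΩ
  rw [← indicator_of_mem hxΩ (w - w' : L2Field Ω), hx hxΩ]
  rfl

/-- The divergence of `h × φ` integrates to zero over space, and `φ` is supported in `Ω`, so no
regularity of the boundary enters. -/
theorem IsC1Field.hasWeakCurl {Ω : Set E3} {h : E3 → E3} (hh : IsC1Field h)
    {u : L2Field Ω} (hu : ∀ᵐ x ∂volume.restrict Ω, u x = h x) :
    HasWeakCurl Ω u ((hh.memLp_curl Ω).toLp (curl h)) := by
  intro φ hφ hc hs
  have hφ1 : IsC1Field φ := ⟨hφ.of_le (by simp), hc⟩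
  have e1 : ∫ x in Ω, inner ℝ (u x) (curl φ x) = ∫ x in Ω, inner ℝ (h x) (curl φ x) :=
    integral_congr_ae (by filter_upwards [hu] with x hx; rw [hx])
  have e2 : ∫ x in Ω, inner ℝ ((hh.memLp_curl Ω).toLp (curl h) x) (φ x) =
      ∫ x in Ω, inner ℝ (curl h x) (φ x) :=
    integral_congr_ae (by filter_upwards [(hh.memLp_curl Ω).coeFn_toLp] with x hx; rw [hx])
  have h0 := integral_divergence_eq_zero (hh.cross hφ1).1 (hh.cross hφ1).2
  simp_rw [fun x => divergence_cross (hh.differentiable x) (hφ1.differentiable x)] at h0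
  rw [integral_sub (integrable_inner_of_memLp (memLp_of_continuous hφ1.1.continuous hc)
      (memLp_of_continuous (continuous_curl hh.1) (hasCompactSupport_curl hh.2)))
    (integrable_inner_of_memLp (memLp_of_continuous hh.1.continuous hh.2)
      (memLp_of_continuous (continuous_curl hφ1.1) (hasCompactSupport_curl hc)))] at h0
  rw [e1, e2, setIntegral_eq_integral_of_forall_compl_eq_zero,
    setIntegral_eq_integral_of_forall_compl_eq_zero]
  · simp_rw [real_inner_comm (φ _) (curl h _)]
    linarith
  · intro x hx
    rw [image_eq_zero_of_notMem_tsupport fun h => hx (hs h), inner_zero_right]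
  · intro x hx
    rw [curl_eq_zero_of_notMem fun h => hx (hs h), inner_zero_right]

theorem tendsto_integral_inner_of_eLpNorm {Ω : Set E3} {f g : ℕ → E3 → E3} {u v : L2Field Ω}
    (hf : ∀ k, MemLp (f k) 2 (volume.restrict Ω)) (hg : ∀ k, MemLp (g k) 2 (volume.restrict Ω))
    (hfu : Tendsto (fun k => eLpNorm (fun x => f k x - u x) 2 (volume.restrict Ω)) atTop (𝓝 0))
    (hgv : Tendsto (fun k => eLpNorm (fun x => g k x - v x) 2 (volume.restrict Ω)) atTop (𝓝 0)) :
    Tendsto (fun k => ∫ x in Ω, inner ℝ (f k x) (g k x)) atTop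
      (𝓝 (∫ x in Ω, inner ℝ (u x) (v x))) := by
  have key : ∀ {f : ℕ → E3 → E3} {u : L2Field Ω} (hf : ∀ k, MemLp (f k) 2 (volume.restrict Ω)),
      Tendsto (fun k => eLpNorm (fun x => f k x - u x) 2 (volume.restrict Ω)) atTop (𝓝 0) →
      Tendsto (fun k => (hf k).toLp (f k)) atTop (𝓝 u) := by
    intro f u hf hfu
    rw [Lp.tendsto_Lp_iff_tendsto_eLpNorm']
    refine hfu.congr fun k => eLpNorm_congr_ae ?_
    filter_upwards [(hf k).coeFn_toLp] with x hx
    rw [Pi.sub_apply, hx]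
  have h1 := (key hf hfu).inner (𝕜 := ℝ) (key hg hgv)
  simp_rw [L2.inner_def] at h1
  refine h1.congr fun k => integral_congr_ae ?_
  filter_upwards [(hf k).coeFn_toLp, (hg k).coeFn_toLp] with x hx1 hx2
  rw [hx1, hx2]

/-- Green's formula for `C¹` fields. -/
theorem IsLipschitzDomain.surfaceFlux_eq {Ω : Set E3} (hΩ : IsLipschitzDomain Ω) {h e : E3 → E3}
    (hh : IsC1Field h) (he : IsC1Field e) :
    surfaceFlux Ω h e =
      (∫ x in Ω, inner ℝ (e x) (curl h x)) - ∫ x in Ω, inner ℝ (h x) (curl e x) := by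
  unfold surfaceFlux fluxDensity
  rw [(hΩ.divergence_theorem (hh.cross he)).2,
    ← integral_sub (integrable_inner_of_memLp (he.memLp Ω) (hh.memLp_curl Ω))
      (integrable_inner_of_memLp (hh.memLp Ω) (he.memLp_curl Ω))]
  simp_rw [fun x => divergence_cross (hh.differentiable x) (he.differentiable x)]

/-- Density supplies the approximations; Green's formula rewrites each surface integral as `L²`
pairings, which converge because both factors converge strongly. -/
theorem IsLipschitzDomain.hasBoundaryFlux {Ω : Set E3} (hΩ : IsLipschitzDomain Ω)
    {u v cu cv : L2Field Ω} (hu : HasWeakCurl Ω u cu) (hv : HasWeakCurl Ω v cv) :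
    HasBoundaryFlux Ω u v (inner ℝ v cu - inner ℝ u cv) := by
  refine ⟨hu.exists_approximation hΩ, hv.exists_approximation hΩ, ?_⟩
  rintro f g ⟨hf, w₁, hw₁, hf1, hf2⟩ ⟨hg, w₂, hw₂, hg1, hg2⟩
  obtain rfl := hu.unique hΩ.isOpen hw₁
  obtain rfl := hv.unique hΩ.isOpen hw₂
  simp_rw [fun k => hΩ.surfaceFlux_eq (hf k) (hg k), L2.inner_def]
  exact (tendsto_integral_inner_of_eLpNorm (fun k => (hg k).memLp Ω)
      (fun k => (hf k).memLp_curl Ω) hg1 hf2).sub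
    (tendsto_integral_inner_of_eLpNorm (fun k => (hf k).memLp Ω)
      (fun k => (hg k).memLp_curl Ω) hf1 hg2)

theorem IsC1Field.approximatesInHCurl {Ω : Set E3} {h : E3 → E3} (hh : IsC1Field h)
    {u : L2Field Ω} (hu : ∀ᵐ x ∂volume.restrict Ω, u x = h x) :
    ApproximatesInHCurl Ω (fun _ => h) u := by
  refine ⟨fun _ => hh, _, hh.hasWeakCurl hu, ?_, ?_⟩
  · have h0 : eLpNorm (fun x => h x - u x) 2 (volume.restrict Ω) = 0 := by
      rw [← eLpNorm_zero (ε := E3) (p := 2) (μ := volume.restrict Ω)]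
      refine eLpNorm_congr_ae ?_
      filter_upwards [hu] with x hx
      simp [hx]
    simp_rw [h0]
    exact tendsto_const_nhds
  · have h0 : eLpNorm (fun x => curl h x - (hh.memLp_curl Ω).toLp (curl h) x) 2
        (volume.restrict Ω) = 0 := by
      rw [← eLpNorm_zero (ε := E3) (p := 2) (μ := volume.restrict Ω)]
      refine eLpNorm_congr_ae ?_
      filter_upwards [(hh.memLp_curl Ω).coeFn_toLp] with x hx
      simp [hx]
    simp_rw [h0]
    exact tendsto_const_nhds

/-! ### The energy balance -/

theorem hamiltonian_eq (Ω : Set E3) (ε₀ μ₀ : ℝ) (D B : L2Field Ω) :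
    hamiltonian Ω ε₀ μ₀ D B = (1 / 2) * ((1 / ε₀) * ‖D‖ ^ 2 + (1 / μ₀) * ‖B‖ ^ 2) := by
  have key : ∀ F : L2Field Ω, Integrable (fun x => ‖F x‖ ^ 2) (volume.restrict Ω) ∧
      ‖F‖ ^ 2 = ∫ x in Ω, ‖F x‖ ^ 2 := by
    intro F
    refine ⟨(Lp.memLp F).integrable_norm_pow (by norm_num), ?_⟩
    rw [← real_inner_self_eq_norm_sq, L2.inner_def]
    simp_rw [real_inner_self_eq_norm_sq]
  rw [hamiltonian, integral_add ((key D).1.const_mul _) ((key B).1.const_mul _),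
    integral_const_mul, integral_const_mul, (key D).2, (key B).2]

/-- The factors `1 / ε₀` and `1 / μ₀` turn `D` and `B` in the derivatives of the squared norms into
`E` and `H`. -/
theorem IsSolution.hasDerivWithinAt_hamiltonian {Ω : Set E3} {ε₀ μ₀ : ℝ} {I : Set ℝ}
    {D B E H J : ℝ → L2Field Ω} (hsol : IsSolution Ω ε₀ μ₀ I D B E H J) {t : ℝ} (ht : t ∈ I)
    (hΩ : IsOpen Ω) {cH cE : L2Field Ω} (hH : HasWeakCurl Ω (H t) cH)
    (hE : HasWeakCurl Ω (E t) cE) :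
    HasDerivWithinAt (fun s => hamiltonian Ω ε₀ μ₀ (D s) (B s))
      ((inner ℝ (E t) cH - inner ℝ (H t) cE) - ∫ x in Ω, inner ℝ (J t x) (E t x)) I t := by
  obtain ⟨cH', hH', hD⟩ := hsol.ampere t ht
  obtain ⟨cE', hE', hB⟩ := hsol.faraday t ht
  obtain rfl := hH.unique hΩ hH'
  obtain rfl := hE.unique hΩ hE'
  simp_rw [hamiltonian_eq]
  have h := ((hD.norm_sq.const_mul (1 / ε₀)).add (hB.norm_sq.const_mul (1 / μ₀))).const_mul
    (1 / 2 : ℝ)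
  refine h.congr_deriv ?_
  rw [← L2.inner_def, hsol.electric_law t ht, hsol.magnetic_law t ht, inner_sub_right,
    inner_neg_right, real_inner_smul_left, real_inner_smul_left, real_inner_smul_right,
    real_inner_comm (D t) (J t)]
  ring

end Maxwell

/-! ### The power balance. -/

theorem mainTheorem8 (Ω : Set Maxwell.E3) (hΩ : Maxwell.IsLipschitzDomain Ω)
    (ε₀ μ₀ : ℝ) (hε₀ : 0 < ε₀) (hμ₀ : 0 < μ₀) (I : Set ℝ)
    (D B E H J : ℝ → Maxwell.L2Field Ω) (hsol : Maxwell.IsSolution Ω ε₀ μ₀ I D B E H J)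
    (t : ℝ) (ht : t ∈ I) :
    (∃ P : ℝ, Maxwell.HasBoundaryFlux Ω (H t) (E t) P ∧
      HasDerivWithinAt (fun s => Maxwell.hamiltonian Ω ε₀ μ₀ (D s) (B s))
        (P - ∫ x in Ω, inner ℝ (J t x) (E t x)) I t) ∧
    (∀ h e : Maxwell.E3 → Maxwell.E3, Maxwell.IsC1Field h → Maxwell.IsC1Field e →
      (∀ᵐ x ∂(volume.restrict Ω), H t x = h x) → (∀ᵐ x ∂(volume.restrict Ω), E t x = e x) →
      IntegrableOn (Maxwell.fluxDensity Ω h e) (frontier Ω) μHE[2] ∧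
      HasDerivWithinAt (fun s => Maxwell.hamiltonian Ω ε₀ μ₀ (D s) (B s))
        ((∫ x in frontier Ω, inner ℝ (Maxwell.cross (h x) (e x)) (Maxwell.outerNormal Ω x) ∂μHE[2])
          - ∫ x in Ω, inner ℝ (J t x) (E t x)) I t) := by
  obtain ⟨cH, hH, -⟩ := hsol.ampere t ht
  obtain ⟨cE, hE, -⟩ := hsol.faraday t ht
  have hflux := hΩ.hasBoundaryFlux hH hE
  have hderiv := hsol.hasDerivWithinAt_hamiltonian ht hΩ.isOpen hH hE
  refine ⟨⟨_, hflux, hderiv⟩, fun h e hh he hHh hEe => ?_⟩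
  refine ⟨(hΩ.divergence_theorem (hh.cross he)).1, ?_⟩
  -- For `C¹` fields the constant sequences are admissible approximations, so the limit must be the
  -- surface integral itself.
  have hlim := hflux.2.2 _ _ (hh.approximatesInHCurl hHh) (he.approximatesInHCurl hEe)
  have heq : Maxwell.surfaceFlux Ω h e = _ := tendsto_nhds_unique tendsto_const_nhds hlim
  rw [← heq] at hderiv
  exact hderiv
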